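/- Let $\beta>0$ and $a>0$ be constants, let $M$ be a compact smooth manifold without boundary, with a $C^1$ Riemannian metric $h_0$, and equip the collar $(0,a]\times M$ with the metric $g=dx^2+x^{-\beta}h_0$. Let $\overline X$ be the metric completion of $((0,a]\times M,g)$ (distances between points of different connected components being $+\infty$). For every $m\in M$ the limit $\iota(m)=\lim_{x\to0^+}(x,m)$ exists in $\overline X$, and $\iota$ is a bijection of $M$ onto $\overline X\setminus((0,a]\times M)$, the boundary copy $\{0\}\times M$ of $M$ in $\overline X$. Let $d_\partial(p,q)=d_{\overline X}(\iota(p),\iota(q))$ be the restriction of the distance of $\overline X$ to this boundary. Then for every $p\in M$, as $q\to p$ in $M$, $$d_\partial(p,q)=c_\beta\,d_{h_0}(p,q)^{\frac{2}{2+\beta}}\,(1+\mathrm{o}(1)),$$ where $$c_\beta=2\left(\frac{2+\beta}{4}\right)^{\frac{2}{2+\beta}}\left(\frac{\sqrt\pi}{\beta}\,\frac{\Gamma(\frac1\beta)}{\Gamma(\frac1\beta+\frac12)}\right)^{\frac{\beta}{2+\beta}}.$$ -/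

import Mathlib

open Set Filter Topology UniformSpace Manifold Bundle
open scoped ENNReal ContDiff Uniformity

noncomputable section

section MetricCompletion

variable {α : Type*} [PseudoEMetricSpace α]

/-- The extended distance on the completion, obtained by extending the extended distance of `α` by
continuity. (Mathlib only treats the case in which all distances are finite.) -/
def completionEDist (x y : Completion α) : ℝ≥0∞ :=
  (Completion.isDenseInducing_coe.prodMap Completion.isDenseInducing_coe).extend
    (fun p : α × α ↦ edist p.1 p.2) (x, y)

theorem completionEDist_continuous :
    Continuous fun p : Completion α × Completion α ↦ completionEDist p.1 p.2 := by
  refine (Completion.isDenseInducing_coe.prodMap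
    Completion.isDenseInducing_coe).continuous_extend fun b ↦ ?_
  set F : Filter (α × α) :=
    comap (Prod.map ((↑) : α → Completion α) ((↑) : α → Completion α)) (𝓝 b) with hF
  have key : ∀ ε : ℝ≥0∞, 0 < ε → ∃ s ∈ F, ∀ z ∈ s, ∀ z' ∈ s,
      edist z.1 z.2 ≤ edist z'.1 z'.2 + ε := by
    intro ε hε
    have hU : {p : α × α | edist p.1 p.2 < ε / 2} ∈ 𝓤 α :=
      edist_mem_uniformity (ENNReal.half_pos hε.ne')
    have hc : ∀ c : Completion α, ∃ t ∈ 𝓝 c, ∀ u v : α, (u : Completion α) ∈ t →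
        (v : Completion α) ∈ t → edist u v < ε / 2 := by
      intro c
      rw [← (Completion.isUniformInducing_coe α).comap_uniformity] at hU
      obtain ⟨V, hV, hVU⟩ := hU
      obtain ⟨W, hW, hWs, hWV⟩ := comp_symm_mem_uniformity_sets hV
      refine ⟨UniformSpace.ball c W, UniformSpace.ball_mem_nhds c hW, fun u v hu hv ↦ ?_⟩
      exact hVU (a := (u, v)) (hWV ⟨c, hWs.symm _ _ hu, hv⟩)
    obtain ⟨t₁, ht₁, h₁⟩ := hc b.1
    obtain ⟨t₂, ht₂, h₂⟩ := hc b.2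
    refine ⟨_, preimage_mem_comap (prod_mem_nhds ht₁ ht₂ : t₁ ×ˢ t₂ ∈ 𝓝 (b.1, b.2)), ?_⟩
    rintro ⟨u, v⟩ ⟨hu, hv⟩ ⟨u', v'⟩ ⟨hu', hv'⟩
    calc edist u v ≤ edist u u' + edist u' v' + edist v' v := edist_triangle4 _ _ _ _
      _ ≤ ε / 2 + edist u' v' + ε / 2 := by
        gcongr
        · exact (h₁ _ _ hu hu').le
        · exact (h₂ _ _ hv' hv).le
      _ = edist u' v' + ε := by
        rw [add_comm (ε / 2), add_assoc, ENNReal.add_halves]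
  have : F.NeBot := (Completion.isDenseInducing_coe.prodMap
    Completion.isDenseInducing_coe).comap_nhds_neBot b
  refine ⟨liminf (fun p : α × α ↦ edist p.1 p.2) F, ?_⟩
  refine tendsto_of_le_liminf_of_limsup_le le_rfl ?_
  refine ENNReal.le_of_forall_pos_le_add fun ε hε _ ↦ ?_
  obtain ⟨s, hs, h⟩ := key ε (by exact_mod_cast hε)
  calc limsup (fun p : α × α ↦ edist p.1 p.2) F
      ≤ ⨅ z' ∈ s, (edist z'.1 z'.2 + ε) :=
        le_iInf₂ fun z' hz' ↦ limsup_le_of_le (h := by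
          filter_upwards [hs] with z hz using h z hz z' hz')
    _ ≤ liminf (fun p : α × α ↦ edist p.1 p.2) F + ε := by
        refine ENNReal.le_of_forall_pos_le_add fun δ hδ hlt ↦ ?_
        have hfin : liminf (fun p : α × α ↦ edist p.1 p.2) F ≠ ⊤ :=
          ne_top_of_le_ne_top hlt.ne le_self_add
        have hfr : ∃ᶠ z in F, edist z.1 z.2
            < liminf (fun p : α × α ↦ edist p.1 p.2) F + δ :=
          frequently_lt_of_liminf_lt (by isBoundedDefault)
            (ENNReal.lt_add_right hfin (by exact_mod_cast hδ.ne'))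
        obtain ⟨z, hz, hzs⟩ := (hfr.and_eventually hs).exists
        refine (iInf₂_le z hzs).trans ?_
        calc edist z.1 z.2 + ε ≤ (liminf (fun p : α × α ↦ edist p.1 p.2) F + δ) + ε := by gcongr
          _ = _ := by ring

theorem completionEDist_coe (x y : α) :
    completionEDist (x : Completion α) (y : Completion α) = edist x y :=
  (Completion.isDenseInducing_coe.prodMap Completion.isDenseInducing_coe).extend_eq
    (f := fun p : α × α ↦ edist p.1 p.2) continuous_edist (x, y)

/-- The metric completion of an extended (pseudo)metric space: the Hausdorff completion of the
underlying uniform space, with the continuous extension of the distance. It is complete, and the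
canonical map has dense range and preserves distances. -/
@[reducible] def completionEMetricSpace : EMetricSpace (Completion α) :=
  @EMetricSpace.ofT0PseudoEMetricSpace _
    { edist := completionEDist
      edist_self := fun x ↦ by
        refine Completion.induction_on x ?_ fun a ↦ ?_
        · exact isClosed_eq
            (completionEDist_continuous.comp (continuous_id.prodMk continuous_id))
            continuous_const
        · rw [completionEDist_coe, edist_self]
      edist_comm := fun x y ↦ by
        refine Completion.induction_on₂ x y ?_ fun a b ↦ ?_
        · exact isClosed_eq completionEDist_continuous
            (completionEDist_continuous.comp (continuous_snd.prodMk continuous_fst))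
        · rw [completionEDist_coe, completionEDist_coe, edist_comm]
      edist_triangle := fun x y z ↦ by
        refine Completion.induction_on₃ x y z ?_ fun a b c ↦ ?_
        · exact isClosed_le
            (completionEDist_continuous.comp (continuous_fst.prodMk continuous_snd.snd))
            ((completionEDist_continuous.comp (continuous_fst.prodMk continuous_snd.fst)).add
              (completionEDist_continuous.comp (continuous_snd.fst.prodMk continuous_snd.snd)))
        · simp only [completionEDist_coe]
          exact edist_triangle a b c
      toUniformSpace := inferInstance
      uniformity_edist := by
        refine le_antisymm (le_iInf₂ fun ε hε ↦ le_principal_iff.2 ?_) fun s hs ↦ ?_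
        · obtain ⟨δ, hδ, hδε⟩ := exists_between (show (0 : ℝ≥0∞) < ε from hε)
          have hU : {p : α × α | edist p.1 p.2 < δ} ∈ 𝓤 α := edist_mem_uniformity hδ
          rw [← (Completion.isUniformInducing_coe α).comap_uniformity] at hU
          obtain ⟨V, hV, hVU⟩ := hU
          refine mem_of_superset (interior_mem_uniformity hV) ?_
          rintro ⟨x, y⟩ hxy
          refine lt_of_le_of_lt ?_ hδε
          have hd : DenseRange (Prod.map ((↑) : α → Completion α) ((↑) : α → Completion α)) :=
            Completion.denseRange_coe.prodMap Completion.denseRange_coe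
          have hcl := hd.open_subset_closure_inter isOpen_interior hxy
          refine closure_minimal ?_
            (isClosed_le completionEDist_continuous continuous_const) hcl
          rintro _ ⟨hp, ⟨u, v⟩, rfl⟩
          change completionEDist (u : Completion α) v ≤ δ
          rw [completionEDist_coe]
          exact (hVU (a := (u, v)) ((interior_subset hp : ((u : Completion α), (v : Completion α)) ∈ V))).le
        · obtain ⟨t, ht, htc, hts⟩ := mem_uniformity_isClosed hs
          have hA := uniformContinuous_def.1 (Completion.uniformContinuous_coe α) t ht
          obtain ⟨ε, hε, hA⟩ := mem_uniformity_edist.1 hA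
          refine mem_of_superset (mem_iInf_of_mem ε (mem_iInf_of_mem hε (mem_principal_self _))) ?_
          rintro ⟨x, y⟩ hxy
          refine hts ?_
          have : ε ≤ completionEDist x y ∨ (x, y) ∈ t := by
            refine Completion.induction_on₂ x y ?_ fun u v ↦ ?_
            · exact (isClosed_le continuous_const completionEDist_continuous).union htc
            · rw [completionEDist_coe]
              exact (le_or_gt ε (edist u v)).imp id fun h ↦ hA h
          exact this.resolve_left (not_le.2 hxy) }
    inferInstance

end MetricCompletion

/-- The collar `(0, a] × M`. The model `I` of `M` and the exponent `β` of the metric are recorded in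
the type because the distance depends on them. -/
structure Collar {E : Type*} [NormedAddCommGroup E] [NormedSpace ℝ E] {H : Type*}
    [TopologicalSpace H] (I : ModelWithCorners ℝ E H) (M : Type*) (β a : ℝ) where
  /-- the coordinate `x` -/
  height : ℝ
  /-- the point of `M` -/
  base : M
  height_mem : height ∈ Ioc 0 a

section Collar

variable {E : Type*} [NormedAddCommGroup E] [NormedSpace ℝ E]
  {H : Type*} [TopologicalSpace H] (I : ModelWithCorners ℝ E H)
  {M : Type*} [TopologicalSpace M] [ChartedSpace H M]
  [RiemannianBundle (fun m : M ↦ TangentSpace I m)]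

/-- The quadratic form `g = dx² + x^(-β) h₀` on the tangent space of `ℝ × M` at `P = (x, m)`,
evaluated on the tangent vector `v = (v.1, v.2)`, where `h₀` is the given Riemannian metric
of `M`. -/
def collarMetric (β : ℝ) (P : ℝ × M) (v : TangentSpace (𝓘(ℝ, ℝ).prod I) P) : ℝ :=
  letI s : ℝ := (show ℝ × E from v).1
  letI w : TangentSpace I P.2 := (show ℝ × E from v).2
  s ^ 2 + P.1 ^ (-β) * inner ℝ w w

/-- The length `√(g(v, v))` of a tangent vector. -/
@[reducible] def collarENorm (β : ℝ) (P : ℝ × M) :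
    ENorm (TangentSpace (𝓘(ℝ, ℝ).prod I) P) :=
  ⟨fun v ↦ ENNReal.ofReal (Real.sqrt (collarMetric I β P v))⟩

/-- The `g`-length of the curve `γ : ℝ → ℝ × M` between the times `s` and `t`. -/
def collarLength (β : ℝ) (γ : ℝ → ℝ × M) (s t : ℝ) : ℝ≥0∞ :=
  letI : ∀ P : ℝ × M, ENorm (TangentSpace (𝓘(ℝ, ℝ).prod I) P) := collarENorm I β
  pathELength (𝓘(ℝ, ℝ).prod I) γ s t

variable {I} {β a : ℝ}

/-- The Riemannian distance of the collar `((0, a] × M, g)`: the infimum of the `g`-lengths of the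
`C¹` curves in `(0, a] × M` that join the two points (`∞` if there is none). -/
def collarEDist (P Q : Collar I M β a) : ℝ≥0∞ :=
  ⨅ (γ : ℝ → ℝ × M) (_ : CMDiff[Icc (0 : ℝ) 1] 1 γ)
    (_ : ∀ t ∈ Icc (0 : ℝ) 1, (γ t).1 ∈ Ioc 0 a)
    (_ : γ 0 = (P.height, P.base)) (_ : γ 1 = (Q.height, Q.base)), collarLength I β γ 0 1

theorem collarENormSMulClass (β : ℝ) (P : ℝ × M) :
    letI := collarENorm I β P
    ENormSMulClass ℝ (TangentSpace (𝓘(ℝ, ℝ).prod I) P) := by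
  let _ := collarENorm I β P
  refine ⟨fun c v ↦ ?_⟩
  change ENNReal.ofReal _ = _ * ENNReal.ofReal _
  have h : collarMetric I β P (c • v) = c ^ 2 * collarMetric I β P v := by
    change (c * (show ℝ × E from v).1) ^ 2 + P.1 ^ (-β) *
      inner ℝ (c • (show TangentSpace I P.2 from (show ℝ × E from v).2))
        (c • (show TangentSpace I P.2 from (show ℝ × E from v).2)) = c ^ 2 *
      ((show ℝ × E from v).1 ^ 2 + P.1 ^ (-β) *
        inner ℝ (show TangentSpace I P.2 from (show ℝ × E from v).2)
          (show TangentSpace I P.2 from (show ℝ × E from v).2))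
    rw [real_inner_smul_left, real_inner_smul_right]
    ring
  rw [h, Real.sqrt_mul (sq_nonneg c), Real.sqrt_sq_eq_abs, ENNReal.ofReal_mul (abs_nonneg c),
    ← Real.enorm_eq_ofReal_abs]

/-- Reparametrization: a curve that nearly realizes the distance can be taken constant near its
endpoints. -/
theorem collarEDist_lt {P Q : Collar I M β a} {r : ℝ≥0∞} (hr : collarEDist P Q < r) {s t : ℝ}
    (hst : s < t) :
    ∃ γ : ℝ → ℝ × M, γ s = (P.height, P.base) ∧ γ t = (Q.height, Q.base) ∧ CMDiff 1 γ ∧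
      (∀ u, (γ u).1 ∈ Ioc 0 a) ∧ collarLength I β γ s t < r ∧
      γ =ᶠ[𝓝 s] (fun _ ↦ (P.height, P.base)) ∧ γ =ᶠ[𝓝 t] (fun _ ↦ (Q.height, Q.base)) := by
  simp only [collarEDist, iInf_lt_iff, exists_prop] at hr
  obtain ⟨γ, hγ, hγa, hγ0, hγ1, hlen⟩ := hr
  obtain ⟨s', hs', hs't⟩ := exists_between hst
  obtain ⟨t', hs't', ht't⟩ := exists_between hs't
  let η (u : ℝ) : ℝ := Real.smoothTransition ((t' - s')⁻¹ * (u - s'))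
  have hpos : 0 < t' - s' := sub_pos.2 hs't'
  have hηs (u : ℝ) (hu : u < s') : η u = 0 := by
    refine Real.smoothTransition.zero_of_nonpos ?_
    exact mul_nonpos_of_nonneg_of_nonpos (inv_nonneg.2 hpos.le) (by linarith)
  have hηt (u : ℝ) (hu : t' < u) : η u = 1 := by
    refine Real.smoothTransition.one_of_one_le ?_
    rw [inv_mul_eq_div, one_le_div₀ hpos]
    linarith
  have hηmem (u : ℝ) : η u ∈ Icc (0 : ℝ) 1 :=
    ⟨Real.smoothTransition.nonneg _, Real.smoothTransition.le_one _⟩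
  have hηd : ContDiff ℝ 1 η := by fun_prop
  refine ⟨γ ∘ η, by simp [hηs s hs', hγ0], by simp [hηt t ht't, hγ1], ?_,
    fun u ↦ hγa _ (hηmem u), ?_, ?_, ?_⟩
  · rw [← contMDiffOn_univ]
    exact hγ.comp (contMDiffOn_univ.2 hηd.contMDiff) fun u _ ↦ hηmem u
  · let _ : ∀ P : ℝ × M, ENorm (TangentSpace (𝓘(ℝ, ℝ).prod I) P) := collarENorm I β
    have := collarENormSMulClass (I := I) (M := M) β
    refine lt_of_eq_of_lt ?_ hlen
    change pathELength (𝓘(ℝ, ℝ).prod I) (γ ∘ η) s t = pathELength (𝓘(ℝ, ℝ).prod I) γ 0 1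
    rw [← hηs s hs', ← hηt t ht't]
    refine pathELength_comp_of_monotoneOn hst.le ?_ ?_ ?_
    · refine Monotone.monotoneOn (Real.smoothTransition.monotone.comp fun u v huv ↦ ?_) _
      gcongr
    · exact (hηd.differentiable one_ne_zero).differentiableOn
    · rw [hηs s hs', hηt t ht't]
      exact hγ.mdifferentiableOn one_ne_zero
  · filter_upwards [Iio_mem_nhds hs'] with u hu
    simp [hηs u hu, hγ0]
  · filter_upwards [Ioi_mem_nhds ht't] with u hu
    simp [hηt u hu, hγ1]

theorem collarEDist_le {P Q : Collar I M β a} {γ : ℝ → ℝ × M} {s t : ℝ} (hst : s ≤ t)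
    (hs : γ s = (P.height, P.base)) (ht : γ t = (Q.height, Q.base)) (hγ : CMDiff 1 γ)
    (hγa : ∀ u, (γ u).1 ∈ Ioc 0 a) : collarEDist P Q ≤ collarLength I β γ s t := by
  let η : ℝ → ℝ := fun u ↦ s + u * (t - s)
  have hηd : ContDiff ℝ 1 η := by fun_prop
  have h : collarEDist P Q ≤ collarLength I β (γ ∘ η) 0 1 := by
    refine iInf_le_of_le (γ ∘ η) (iInf_le_of_le ?_ (iInf_le_of_le (fun u _ ↦ hγa _)
      (iInf_le_of_le ?_ (iInf_le_of_le ?_ le_rfl))))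
    · exact (hγ.comp hηd.contMDiff).contMDiffOn
    · simp [η, hs]
    · simp [η, ht]
  refine h.trans_eq ?_
  let _ : ∀ P : ℝ × M, ENorm (TangentSpace (𝓘(ℝ, ℝ).prod I) P) := collarENorm I β
  have := collarENormSMulClass (I := I) (M := M) β
  have h0 : η 0 = s := by simp [η]
  have h1 : η 1 = t := by simp [η]
  change pathELength (𝓘(ℝ, ℝ).prod I) (γ ∘ η) 0 1 = pathELength (𝓘(ℝ, ℝ).prod I) γ s t
  rw [← h0, ← h1]
  refine pathELength_comp_of_monotoneOn zero_le_one ?_ ?_ ?_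
  · refine Monotone.monotoneOn (fun u v huv ↦ ?_) _
    have : 0 ≤ t - s := sub_nonneg.2 hst
    change s + u * (t - s) ≤ s + v * (t - s)
    gcongr
  · exact (hηd.differentiable one_ne_zero).differentiableOn
  · exact (hγ.mdifferentiable one_ne_zero).mdifferentiableOn

theorem collarEDist_self (P : Collar I M β a) : collarEDist P P = 0 := by
  refine le_antisymm ((collarEDist_le (γ := fun _ ↦ (P.height, P.base)) (le_refl (0 : ℝ)) rfl rfl
    contMDiff_const fun _ ↦ P.height_mem).trans_eq ?_) bot_le
  let _ : ∀ P : ℝ × M, ENorm (TangentSpace (𝓘(ℝ, ℝ).prod I) P) := collarENorm I β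
  exact pathELength_self

theorem collarEDist_comm (P Q : Collar I M β a) : collarEDist P Q = collarEDist Q P := by
  suffices H : ∀ P Q : Collar I M β a, collarEDist Q P ≤ collarEDist P Q from
    le_antisymm (H Q P) (H P Q)
  intro P Q
  refine le_of_forall_gt fun r hr ↦ ?_
  obtain ⟨γ, hγ0, hγ1, hγ, hγa, hlen, -⟩ := collarEDist_lt hr zero_lt_one
  have hηd : ContDiff ℝ 1 (fun u : ℝ ↦ -u) := by fun_prop
  have hsm := hγ.comp hηd.contMDiff
  refine (collarEDist_le (γ := γ ∘ fun u ↦ -u) (neg_le_neg zero_le_one) (by simp [hγ1])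
    (by simp [hγ0]) hsm fun u ↦ hγa _).trans_lt (lt_of_eq_of_lt ?_ hlen)
  let _ : ∀ P : ℝ × M, ENorm (TangentSpace (𝓘(ℝ, ℝ).prod I) P) := collarENorm I β
  have := collarENormSMulClass (I := I) (M := M) β
  change pathELength (𝓘(ℝ, ℝ).prod I) (γ ∘ fun u ↦ -u) (-1) (-0) =
    pathELength (𝓘(ℝ, ℝ).prod I) γ 0 1
  have := pathELength_comp_of_antitoneOn (I := 𝓘(ℝ, ℝ).prod I) (γ := γ) (f := fun u ↦ -u)
    (neg_le_neg zero_le_one) (monotone_id.neg.antitoneOn _)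
    (hηd.differentiable one_ne_zero).differentiableOn
    (hγ.mdifferentiable one_ne_zero).mdifferentiableOn
  simpa using this

theorem collarEDist_triangle (P Q R : Collar I M β a) :
    collarEDist P R ≤ collarEDist P Q + collarEDist Q R := by
  refine le_of_forall_gt fun r hr ↦ ?_
  obtain ⟨u, hu, v, hv, huv⟩ := ENNReal.exists_add_lt_of_add_lt hr
  obtain ⟨γ₁, h₁0, h₁1, h₁, h₁a, hl₁, -, hc₁⟩ := collarEDist_lt hu zero_lt_one
  obtain ⟨γ₂, h₂1, h₂2, h₂, h₂a, hl₂, hc₂, -⟩ := collarEDist_lt hv one_lt_two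
  let γ := piecewise (Iic 1) γ₁ γ₂
  have h : collarEDist P R ≤ collarLength I β γ 0 2 := by
    refine collarEDist_le zero_le_two (by simp [γ, h₁0]) (by simp [γ, h₂2]) ?_ fun w ↦ ?_
    · exact ContMDiff.piecewise_Iic h₁ h₂ (hc₁.trans hc₂.symm)
    · by_cases hw : w ∈ Iic (1 : ℝ)
      · simpa [γ, piecewise_eq_of_mem _ _ _ hw] using h₁a w
      · simpa [γ, piecewise_eq_of_notMem _ _ _ hw] using h₂a w
  refine h.trans_lt (lt_trans ?_ huv)
  let _ : ∀ P : ℝ × M, ENorm (TangentSpace (𝓘(ℝ, ℝ).prod I) P) := collarENorm I β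
  change pathELength (𝓘(ℝ, ℝ).prod I) γ 0 2 < u + v
  rw [← pathELength_add zero_le_one one_le_two]
  refine ENNReal.add_lt_add (lt_of_eq_of_lt (pathELength_congr fun w hw ↦ ?_) hl₁)
    (lt_of_eq_of_lt (pathELength_congr_Ioo fun w hw ↦ ?_) hl₂)
  · simp [γ, hw.2]
  · simp [γ, hw.1]

instance : PseudoEMetricSpace (Collar I M β a) where
  edist := collarEDist
  edist_self := collarEDist_self
  edist_comm := collarEDist_comm
  edist_triangle := collarEDist_triangle

/-- The metric completion of the collar. -/
instance : EMetricSpace (Completion (Collar I M β a)) := completionEMetricSpace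

end Collar

/-- The constant `c_β`. -/
def boundaryConst (β : ℝ) : ℝ :=
  2 * ((2 + β) / 4) ^ (2 / (2 + β)) *
    (√Real.pi / β * (Real.Gamma (1 / β) / Real.Gamma (1 / β + 1 / 2))) ^ (β / (2 + β))

end

/-! Everything is compared with the half-plane model dx² + x^(-β) dy², where y is arc length along a
curve of `M`. Put A = `profile β 1 1` and let d be the `h₀`-distance of p and q.

Lower bound: on a curve of maximal height K, Cauchy–Schwarz with the unit vector (√(1-(x/K)^β),
(x/K)^(β/2)) bounds the speed below by √(1-(x/K)^β)|x'| + K^(-β/2) times the `h₀`-speed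
(`profileSlope_mul_abs_add_le`). The first term integrates to at least 2AK up to the endpoint
heights, because the curve rises to K and comes back down; the second gives K^(-β/2) d. The minimum
of 2AK + K^(-β/2) d over K is c_β d^(2/(2+β)) (`boundaryConst_mul_rpow_le`), so this bounds the
distance from below at every scale (`boundaryConst_le_edist`).

Upper bound: Cauchy–Schwarz is sharp along x = h sin^(2/β) t, y' = (2/β) h^(1+β/2) sin^(2/β+1) t.
This model geodesic has width (4A/β) h^(1+β/2) and length 2Ah(1+2/β). Composing y with a curve of
`M` of speed at most one lifts it to the collar as long as h ≤ a (`exists_edist_le_of_height`).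

Hence the boundary distance equals c_β d^(2/(2+β)) exactly once d is small
(`edist_eq_of_isBoundaryLimit`), which is stronger than the asymptotics. The description of the
boundary rests on three estimates: height is 1-Lipschitz, the projection to `M` is Lipschitz because
x^(-β) ≥ a^(-β), and vertical segments have length equal to their change of height. Compactness of
`M` then excludes further points. -/

noncomputable section

/-! ### The one-variable integrals and the constant c_β. -/

section Profile

open intervalIntegral MeasureTheory

/-- The integrand `√(1 - (u/K)^β)`: the part of the `g`-length of a geodesic of maximal height `K`
that is due to the change of height. -/
def profileSlope (β K u : ℝ) : ℝ := √(1 - (u / K) ^ β)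

/-- The primitive of `profileSlope` that vanishes at `0`. -/
def profile (β K x : ℝ) : ℝ := ∫ u in (0 : ℝ)..x, profileSlope β K u

variable {β K : ℝ}

theorem continuous_profileSlope (hβ : 0 ≤ β) : Continuous (profileSlope β K) := by
  unfold profileSlope
  exact (continuous_const.sub
    ((Real.continuous_rpow_const hβ).comp (continuous_id.div_const K))).sqrt

theorem profileSlope_nonneg (u : ℝ) : 0 ≤ profileSlope β K u := Real.sqrt_nonneg _

theorem profileSlope_le_one {u : ℝ} (hK : 0 < K) (hu : 0 ≤ u) : profileSlope β K u ≤ 1 := by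
  refine Real.sqrt_le_one.2 ?_
  have := Real.rpow_nonneg (div_nonneg hu hK.le) β
  linarith

theorem hasDerivAt_profile (hβ : 0 ≤ β) (x : ℝ) :
    HasDerivAt (profile β K) (profileSlope β K x) x :=
  integral_hasDerivAt_right ((continuous_profileSlope hβ).intervalIntegrable _ _)
    ((continuous_profileSlope hβ).stronglyMeasurableAtFilter _ _)
    (continuous_profileSlope hβ).continuousAt

theorem profile_le (hβ : 0 ≤ β) (hK : 0 < K) {x : ℝ} (hx : 0 ≤ x) : profile β K x ≤ x := by
  calc profile β K x ≤ ∫ _ in (0 : ℝ)..x, (1 : ℝ) :=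
        integral_mono_on hx ((continuous_profileSlope hβ).intervalIntegrable _ _)
          (by simp) fun u hu ↦ profileSlope_le_one hK hu.1
    _ = x := by simp

theorem profile_self (hK : 0 < K) : profile β K K = K * profile β 1 1 := by
  unfold profile profileSlope
  have h := integral_comp_div (a := 0) (b := K) (fun u ↦ √(1 - u ^ β)) hK.ne'
  rw [h]
  simp [hK.ne']

theorem profile_one_pos (hβ : 0 < β) : 0 < profile β 1 1 := by
  refine intervalIntegral_pos_of_pos_on
    ((continuous_profileSlope hβ.le).intervalIntegrable _ _) (fun u hu ↦ ?_) one_pos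
  refine Real.sqrt_pos.2 ?_
  have := Real.rpow_lt_one hu.1.le hu.2 hβ
  simpa using this

/-- The substitution y = u^β. Both integrals are written over (0, ∞) with indicators of (0, 1]
because the change of variables for powers is stated on that half-line. -/
theorem profile_one_eq_beta (hβ : 0 < β) :
    profile β 1 1 = β⁻¹ * ProbabilityTheory.beta (1 / β) (3 / 2) := by
  have h1 : ProbabilityTheory.beta (1 / β) (3 / 2) =
      ∫ y in Ioi (0 : ℝ), (Ioc (0 : ℝ) 1).indicator
        (fun y ↦ y ^ (1 / β - 1) * (1 - y) ^ (1 / 2 : ℝ)) y := by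
    rw [ProbabilityTheory.beta_eq_betaIntegralReal _ _ (by positivity) (by norm_num),
      Complex.betaIntegral, setIntegral_indicator measurableSet_Ioc,
      inter_eq_self_of_subset_right Ioc_subset_Ioi_self, integral_of_le zero_le_one]
    have : ∀ y ∈ Ioc (0 : ℝ) 1,
        (y : ℂ) ^ (((1 / β : ℝ) : ℂ) - 1) * (1 - (y : ℂ)) ^ (((3 / 2 : ℝ) : ℂ) - 1) =
          ((y ^ (1 / β - 1) * (1 - y) ^ (1 / 2 : ℝ) : ℝ) : ℂ) := by
      intro y hy
      rw [Complex.ofReal_mul, Complex.ofReal_cpow hy.1.le, Complex.ofReal_cpow (by linarith [hy.2])]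
      push_cast
      norm_num
    rw [setIntegral_congr_fun measurableSet_Ioc this, integral_complex_ofReal, Complex.ofReal_re]
  rw [h1, ← integral_comp_rpow_Ioi _ hβ.ne', profile, integral_of_le zero_le_one,
    ← MeasureTheory.integral_const_mul, ← MeasureTheory.integral_indicator measurableSet_Ioc,
    ← MeasureTheory.integral_indicator measurableSet_Ioi]
  congr 1
  ext u
  by_cases hu : u ∈ Ioi (0 : ℝ)
  · have hu0 : (0 : ℝ) < u := hu
    have hiff : u ^ β ∈ Ioc (0 : ℝ) 1 ↔ u ∈ Ioc (0 : ℝ) 1 := by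
      simp [hu0, Real.rpow_pos_of_pos hu0, Real.rpow_le_one_iff_of_pos hu0, hβ.not_ge,
        hβ.le]
    rw [indicator_of_mem hu]
    by_cases h : u ∈ Ioc (0 : ℝ) 1
    · rw [indicator_of_mem h, indicator_of_mem (hiff.2 h), abs_of_pos hβ, smul_eq_mul,
        ← Real.rpow_mul hu0.le, profileSlope, div_one, Real.sqrt_eq_rpow]
      have e : u ^ (β - 1) * u ^ (β * (1 / β - 1)) = 1 := by
        rw [← Real.rpow_add hu0]
        have : β - 1 + β * (1 / β - 1) = 0 := by field_simp; ring
        rw [this, Real.rpow_zero]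
      have hb : β⁻¹ * β = 1 := inv_mul_cancel₀ hβ.ne'
      generalize u ^ (β - 1) = y at e ⊢
      generalize u ^ (β * (1 / β - 1)) = z at e ⊢
      generalize (1 - u ^ β) ^ (1 / 2 : ℝ) = w
      linear_combination -(w * β⁻¹ * β) * e - w * hb
    · rw [indicator_of_notMem h, indicator_of_notMem (mt hiff.1 h)]
      simp
  · rw [indicator_of_notMem hu, indicator_of_notMem fun h ↦ hu h.1]

theorem profile_one_eq_Gamma (hβ : 0 < β) :
    profile β 1 1 = β / (2 + β) *
      (√Real.pi / β * (Real.Gamma (1 / β) / Real.Gamma (1 / β + 1 / 2))) := by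
  rw [profile_one_eq_beta hβ, ProbabilityTheory.beta]
  have h1 : Real.Gamma (3 / 2) = 1 / 2 * √Real.pi := by
    rw [show (3 / 2 : ℝ) = 1 / 2 + 1 by norm_num, Real.Gamma_add_one (by norm_num),
      Real.Gamma_one_half_eq]
  have h2 : Real.Gamma (1 / β + 3 / 2) = (1 / β + 1 / 2) * Real.Gamma (1 / β + 1 / 2) := by
    rw [← Real.Gamma_add_one (by positivity)]
    ring_nf
  have h3 : Real.Gamma (1 / β + 1 / 2) ≠ 0 := (Real.Gamma_pos_of_pos (by positivity)).ne'
  rw [h1, h2]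
  field_simp

/-- The half-width and the half-length of a geodesic are both multiples of this integral. -/
theorem integral_sin_rpow_eq_profile (hβ : 0 < β) :
    ∫ t in (0 : ℝ)..Real.pi, Real.sin t ^ (2 / β + 1) = 2 * profile β 1 1 := by
  have hq : 0 ≤ 2 / β + 1 := by positivity
  have hc : Continuous fun t : ℝ ↦ Real.sin t ^ (2 / β + 1) :=
    (Real.continuous_rpow_const hq).comp Real.continuous_sin
  have hc2 : Continuous fun t : ℝ ↦ Real.sin t ^ (2 / β) :=
    (Real.continuous_rpow_const (by positivity)).comp Real.continuous_sin
  have hpi := Real.pi_pos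
  have hsym : ∫ t in (Real.pi / 2)..Real.pi, Real.sin t ^ (2 / β + 1) =
      ∫ t in (0 : ℝ)..(Real.pi / 2), Real.sin t ^ (2 / β + 1) := by
    have := integral_comp_sub_left (a := 0) (b := Real.pi / 2)
      (fun t ↦ Real.sin t ^ (2 / β + 1)) Real.pi
    simp only [Real.sin_pi_sub, sub_zero] at this
    rw [this]
    congr 1
    ring
  have hhalf : profile β 1 1 = ∫ t in (0 : ℝ)..(Real.pi / 2), Real.sin t ^ (2 / β + 1) := by
    -- At u = sin^(2/β) t the slope √(1-u^β) is cos t, so the derivative of the first term is (2/β)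
    -- sin^(2/β-1) t cos² t. The product subtracted cancels it and leaves sin^(2/β+1) t.
    set G : ℝ → ℝ := fun t ↦ profile β 1 (Real.sin t ^ (2 / β)) -
      Real.sin t ^ (2 / β) * Real.cos t with hG
    -- Only the open interval is possible: sin^(2/β) is not differentiable at 0 when β > 2.
    have hGd : ∀ t ∈ Ioo (0 : ℝ) (Real.pi / 2),
        HasDerivAt G (Real.sin t ^ (2 / β + 1)) t := by
      intro t ht
      have hs : 0 < Real.sin t := Real.sin_pos_of_pos_of_lt_pi ht.1 (by linarith [ht.2])
      have hcos : 0 < Real.cos t := Real.cos_pos_of_mem_Ioo ⟨by linarith [ht.1], ht.2⟩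
      have h1 : HasDerivAt (fun t ↦ Real.sin t ^ (2 / β))
          (Real.cos t * (2 / β) * Real.sin t ^ (2 / β - 1)) t :=
        (Real.hasDerivAt_sin t).rpow_const (Or.inl hs.ne')
      have h2 := ((hasDerivAt_profile (K := 1) hβ.le _).comp t h1).sub
        (h1.mul (Real.hasDerivAt_cos t))
      refine h2.congr_deriv ?_
      have h3 : profileSlope β 1 (Real.sin t ^ (2 / β)) = Real.cos t := by
        rw [profileSlope, div_one, ← Real.rpow_mul hs.le, div_mul_cancel₀ _ hβ.ne',
          Real.rpow_two, ← Real.cos_sq', Real.sqrt_sq hcos.le]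
      rw [h3, Real.rpow_add_one hs.ne']
      ring
    have hGc : ContinuousOn G (Icc 0 (Real.pi / 2)) := by
      have : Continuous (profile β 1) :=
        continuous_iff_continuousAt.2 fun x ↦ (hasDerivAt_profile hβ.le x).continuousAt
      exact ((this.comp hc2).sub (hc2.mul Real.continuous_cos)).continuousOn
    rw [integral_eq_sub_of_hasDerivAt_of_le (by positivity) hGc hGd
      (hc.intervalIntegrable _ _)]
    have : (2 / β) ≠ 0 := by positivity
    simp [hG, Real.zero_rpow this, profile]
  rw [← integral_add_adjacent_intervals (hc.intervalIntegrable 0 (Real.pi / 2))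
    (hc.intervalIntegrable _ _), hsym, hhalf]
  ring

/-- Removes the Gamma functions: later arguments use the constant only through A. -/
theorem boundaryConst_eq (hβ : 0 < β) :
    boundaryConst β = 2 * ((2 + β) / 4) ^ (2 / (2 + β)) *
      ((2 + β) / β * profile β 1 1) ^ (β / (2 + β)) := by
  rw [boundaryConst, profile_one_eq_Gamma hβ]
  congr 2
  field_simp

/-- The length of a geodesic in terms of its maximal height `H`. -/
theorem boundaryConst_mul_rpow (hβ : 0 < β) {H : ℝ} (hH : 0 < H) :
    boundaryConst β * (4 * profile β 1 1 / β * H ^ (1 + β / 2)) ^ (2 / (2 + β)) =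
      2 * profile β 1 1 * H * (1 + 2 / β) := by
  have hA := profile_one_pos hβ
  have h2 : 0 < 2 + β := by linarith
  have hpow : ((4 * profile β 1 1 / β) * H ^ (1 + β / 2)) ^ (2 / (2 + β)) =
      (4 * profile β 1 1 / β) ^ (2 / (2 + β)) * H := by
    rw [Real.mul_rpow (by positivity) (by positivity), ← Real.rpow_mul hH.le]
    have : (1 + β / 2) * (2 / (2 + β)) = 1 := by field_simp
    rw [this, Real.rpow_one]
  rw [boundaryConst_eq hβ, hpow]
  -- The two bases multiply to (2+β)A/β, the base of the remaining factor, and the exponents 2/(2+β)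
  -- and β/(2+β) add up to 1.
  have e1 : ((2 + β) / 4) ^ (2 / (2 + β)) * (4 * profile β 1 1 / β) ^ (2 / (2 + β)) =
      ((2 + β) / β * profile β 1 1) ^ (2 / (2 + β)) := by
    rw [← Real.mul_rpow (by positivity) (by positivity)]
    congr 1
    field_simp
  have e2 : ((2 + β) / β * profile β 1 1) ^ (2 / (2 + β)) *
      ((2 + β) / β * profile β 1 1) ^ (β / (2 + β)) = (2 + β) / β * profile β 1 1 := by
    rw [← Real.rpow_add (by positivity), ← add_div, div_self h2.ne', Real.rpow_one]
  calc _ = 2 * ((((2 + β) / 4) ^ (2 / (2 + β)) * (4 * profile β 1 1 / β) ^ (2 / (2 + β))) *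
        ((2 + β) / β * profile β 1 1) ^ (β / (2 + β))) * H := by ring
    _ = 2 * profile β 1 1 * H * (1 + 2 / β) := by
      rw [e1, e2]
      field_simp
      ring

/-- This height is the critical point of K ↦ 2AK + K^(-β/2) L; the critical equation says exactly
that the model geodesic of this height has width L. -/
theorem exists_height (hβ : 0 < β) {L : ℝ} (hL : 0 < L) :
    0 < (β * L / (4 * profile β 1 1)) ^ (2 / (2 + β)) ∧
    4 * profile β 1 1 / β * ((β * L / (4 * profile β 1 1)) ^ (2 / (2 + β))) ^ (1 + β / 2) = L := by
  have hA := profile_one_pos hβ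
  refine ⟨by positivity, ?_⟩
  rw [← Real.rpow_mul (by positivity)]
  have : 2 / (2 + β) * (1 + β / 2) = 1 := by field_simp
  rw [this, Real.rpow_one]
  field_simp

/-- Among all heights `K` the lower bound for the length is smallest at the height of the
geodesic. -/
theorem boundaryConst_mul_rpow_le (hβ : 0 < β) {K L : ℝ} (hK : 0 < K) (hL : 0 ≤ L) :
    boundaryConst β * L ^ (2 / (2 + β)) ≤ 2 * profile β 1 1 * K + K ^ (-(β / 2)) * L := by
  have hA := profile_one_pos hβ
  rcases hL.eq_or_lt with rfl | hL
  · rw [Real.zero_rpow (by positivity)]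
    simp only [mul_zero, add_zero]
    positivity
  obtain ⟨hH, hHL⟩ := exists_height hβ hL
  set H := (β * L / (4 * profile β 1 1)) ^ (2 / (2 + β))
  rw [← hHL, boundaryConst_mul_rpow hβ hH]
  have hr : 0 < K / H := by positivity
  -- The convex function r ↦ r^(-β/2) lies above its tangent at r = 1. With this tangent in place of
  -- the power, the terms in K cancel.
  have h1 : 1 - β / 2 * (K / H - 1) ≤ (K / H) ^ (-(β / 2)) := by
    rw [Real.rpow_def_of_pos hr]
    have h2 := Real.log_le_sub_one_of_pos hr
    have h3 := Real.add_one_le_exp (Real.log (K / H) * -(β / 2))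
    nlinarith
  have h4 : K ^ (-(β / 2)) = (K / H) ^ (-(β / 2)) * H ^ (-(β / 2)) := by
    rw [← Real.mul_rpow hr.le hH.le, div_mul_cancel₀ _ hH.ne']
  have h5 : H ^ (-(β / 2)) * H ^ (1 + β / 2) = H := by
    rw [← Real.rpow_add hH]
    simp
  calc 2 * profile β 1 1 * H * (1 + 2 / β)
      = 2 * profile β 1 1 * K +
          4 * profile β 1 1 / β * H * (1 - β / 2 * (K / H - 1)) := by field_simp; ring
    _ ≤ 2 * profile β 1 1 * K + 4 * profile β 1 1 / β * H * (K / H) ^ (-(β / 2)) := by gcongr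
    _ = _ := by
      rw [h4]
      linear_combination (4 * profile β 1 1 / β * (K / H) ^ (-(β / 2))) * (-h5)

end Profile

/-! ### Lower bounds for lengths of curves in the collar. -/

section Length

open MeasureTheory

variable {E : Type*} [NormedAddCommGroup E] [NormedSpace ℝ E]
  {H : Type*} [TopologicalSpace H] {I : ModelWithCorners ℝ E H}
  {M : Type*} [TopologicalSpace M] [ChartedSpace H M]
  [RiemannianBundle (fun m : M ↦ TangentSpace I m)] {β a : ℝ}

/-- The `h₀`-speed of a curve in `M`. -/
def baseSpeed (I : ModelWithCorners ℝ E H) {M : Type*} [TopologicalSpace M] [ChartedSpace H M]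
    [RiemannianBundle (fun m : M ↦ TangentSpace I m)] (σ : ℝ → M) (t : ℝ) : ℝ :=
  ‖(mfderiv 𝓘(ℝ, ℝ) I σ t (1 : ℝ) : TangentSpace I (σ t))‖

theorem baseSpeed_nonneg (σ : ℝ → M) (t : ℝ) : 0 ≤ baseSpeed I σ t := norm_nonneg _

theorem pathELength_eq_baseSpeed (σ : ℝ → M) (s t : ℝ) :
    pathELength I σ s t = ∫⁻ u in Ioo s t, ENNReal.ofReal (baseSpeed I σ u) := by
  rw [pathELength_eq_lintegral_mfderiv_Ioo]
  simp only [baseSpeed, ofReal_norm]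
  rfl

theorem collarMetric_mfderiv {γ : ℝ → ℝ × M} {u : ℝ}
    (hγ : MDifferentiableAt 𝓘(ℝ, ℝ) (𝓘(ℝ, ℝ).prod I) γ u) :
    collarMetric I β (γ u) (mfderiv 𝓘(ℝ, ℝ) (𝓘(ℝ, ℝ).prod I) γ u (1 : ℝ)) =
      deriv (fun v ↦ (γ v).1) u ^ 2 +
        (γ u).1 ^ (-β) * baseSpeed I (fun v ↦ (γ v).2) u ^ 2 := by
  have h1 : MDifferentiableAt 𝓘(ℝ, ℝ) 𝓘(ℝ, ℝ) (fun v ↦ (γ v).1) u := hγ.fst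
  have h2 : MDifferentiableAt 𝓘(ℝ, ℝ) I (fun v ↦ (γ v).2) u := hγ.snd
  have h := mfderiv_prodMk h1 h2
  change mfderiv 𝓘(ℝ, ℝ) (𝓘(ℝ, ℝ).prod I) γ u = _ at h
  rw [h, baseSpeed, ← real_inner_self_eq_norm_sq]
  have h3 : deriv (fun v ↦ (γ v).1) u = mfderiv 𝓘(ℝ, ℝ) 𝓘(ℝ, ℝ) (fun v ↦ (γ v).1) u (1 : ℝ) := by
    rw [mfderiv_eq_fderiv]
    rfl
  rw [h3]
  rfl

theorem collarLength_eq {γ : ℝ → ℝ × M} {s t : ℝ}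
    (hγ : ∀ u ∈ Ioo s t, MDifferentiableAt 𝓘(ℝ, ℝ) (𝓘(ℝ, ℝ).prod I) γ u) :
    collarLength I β γ s t = ∫⁻ u in Ioo s t, ENNReal.ofReal
      (√(deriv (fun v ↦ (γ v).1) u ^ 2 +
        (γ u).1 ^ (-β) * baseSpeed I (fun v ↦ (γ v).2) u ^ 2)) := by
  let _ : ∀ P : ℝ × M, ENorm (TangentSpace (𝓘(ℝ, ℝ).prod I) P) := collarENorm I β
  change pathELength (𝓘(ℝ, ℝ).prod I) γ s t = _
  rw [pathELength_eq_lintegral_mfderiv_Ioo]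
  refine setLIntegral_congr_fun measurableSet_Ioo fun u hu ↦ ?_
  change ENNReal.ofReal (√(collarMetric I β (γ u)
    (mfderiv 𝓘(ℝ, ℝ) (𝓘(ℝ, ℝ).prod I) γ u (1 : ℝ)))) = _
  rw [collarMetric_mfderiv (hγ u hu)]

/-- A lower bound for lengths that comes from a calibration of the tangent vectors. -/
theorem le_collarLength {γ : ℝ → ℝ × M} (hγ : CMDiff 1 γ) {s t c : ℝ} {φ : ℝ → ℝ}
    (hst : s ≤ t) (hc : 0 ≤ c) (hφ : Continuous φ) (hφ0 : ∀ u, 0 ≤ φ u)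
    (h : ∀ u ∈ Ioo s t, φ u + c * baseSpeed I (fun v ↦ (γ v).2) u ≤
      √(deriv (fun v ↦ (γ v).1) u ^ 2 + (γ u).1 ^ (-β) * baseSpeed I (fun v ↦ (γ v).2) u ^ 2)) :
    ENNReal.ofReal (∫ u in s..t, φ u) +
      ENNReal.ofReal c * riemannianEDist I (γ s).2 (γ t).2 ≤ collarLength I β γ s t := by
  rw [collarLength_eq fun u _ ↦ hγ.mdifferentiable one_ne_zero u]
  have hσ : CMDiff 1 (fun v ↦ (γ v).2) := hγ.snd
  calc ENNReal.ofReal (∫ u in s..t, φ u) +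
      ENNReal.ofReal c * riemannianEDist I (γ s).2 (γ t).2
    ≤ (∫⁻ u in Ioo s t, ENNReal.ofReal (φ u)) +
        ENNReal.ofReal c * ∫⁻ u in Ioo s t, ENNReal.ofReal (baseSpeed I (fun v ↦ (γ v).2) u) := by
        gcongr
        · rw [intervalIntegral.integral_of_le hst, ← restrict_Ioo_eq_restrict_Ioc,
            ofReal_integral_eq_lintegral_ofReal]
          · exact (hφ.integrableOn_Icc (a := s) (b := t)).mono_set Ioo_subset_Icc_self
          · exact Eventually.of_forall hφ0
        · rw [← pathELength_eq_baseSpeed]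
          exact riemannianEDist_le_pathELength hσ.contMDiffOn rfl rfl hst
    _ = ∫⁻ u in Ioo s t, (ENNReal.ofReal (φ u) +
          ENNReal.ofReal c * ENNReal.ofReal (baseSpeed I (fun v ↦ (γ v).2) u)) := by
        rw [lintegral_add_left (by fun_prop), lintegral_const_mul' _ _ ENNReal.ofReal_ne_top]
    _ ≤ _ := by
        refine setLIntegral_mono' measurableSet_Ioo fun u hu ↦ ?_
        rw [← ENNReal.ofReal_mul hc, ← ENNReal.ofReal_add (hφ0 u)
          (mul_nonneg hc (baseSpeed_nonneg _ _))]
        exact ENNReal.ofReal_le_ofReal (h u hu)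

/-- The weight x^(-β) is at least a^(-β) on the collar, so dropping dx² costs nothing. This estimate
separates the boundary points. -/
theorem rpow_mul_riemannianEDist_le (hβ : 0 ≤ β) (ha : 0 < a) (P Q : Collar I M β a) :
    ENNReal.ofReal (a ^ (-(β / 2))) * riemannianEDist I P.base Q.base ≤ edist P Q := by
  refine le_of_forall_gt fun r hr ↦ ?_
  obtain ⟨γ, h0, h1, hγ, hγa, hlen, -⟩ := collarEDist_lt hr zero_lt_one
  refine lt_of_le_of_lt ?_ hlen
  have := le_collarLength (β := β) hγ zero_le_one (c := a ^ (-(β / 2))) (φ := 0) (by positivity)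
    continuous_const (fun _ ↦ le_rfl) fun u _ ↦ ?_
  · simpa [h0, h1] using this
  · refine Real.le_sqrt_of_sq_le ?_
    have hx := (hγa u).1
    have : (a ^ (-(β / 2))) ^ 2 ≤ (γ u).1 ^ (-β) := by
      rw [← Real.rpow_natCast, ← Real.rpow_mul ha.le]
      refine (Real.rpow_le_rpow_of_nonpos hx (hγa u).2 (by linarith)).trans' (le_of_eq ?_)
      congr 1
      push_cast
      ring
    simp only [Pi.zero_apply, zero_add, mul_pow]
    have h2 := mul_le_mul_of_nonneg_right this (sq_nonneg (baseSpeed I (fun v ↦ (γ v).2) u))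
    nlinarith [sq_nonneg (deriv (fun v ↦ (γ v).1) u)]

/-- The metric dominates dx². This keeps points of positive height away from the boundary. -/
theorem ofReal_abs_height_sub_le (P Q : Collar I M β a) :
    ENNReal.ofReal |P.height - Q.height| ≤ edist P Q := by
  refine le_of_forall_gt fun r hr ↦ ?_
  obtain ⟨γ, h0, h1, hγ, hγa, hlen, -⟩ := collarEDist_lt hr zero_lt_one
  refine lt_of_le_of_lt ?_ hlen
  have hx : ContDiff ℝ 1 (fun v ↦ (γ v).1) := contMDiff_iff_contDiff.1 hγ.fst
  have hd : Continuous (deriv fun v ↦ (γ v).1) := hx.continuous_deriv le_rfl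
  have := le_collarLength (β := β) hγ zero_le_one (c := 0)
    (φ := fun u ↦ |deriv (fun v ↦ (γ v).1) u|) le_rfl
    hd.abs (fun _ ↦ abs_nonneg _) fun u _ ↦ ?_
  · refine le_trans (le_trans (ENNReal.ofReal_le_ofReal ?_) le_self_add) this
    have h := intervalIntegral.integral_deriv_eq_sub (a := 0) (b := 1)
      (fun u _ ↦ hx.differentiable one_ne_zero u) (hd.intervalIntegrable _ _)
    simp only [h0, h1] at h
    rw [abs_sub_comm, ← h]
    exact intervalIntegral.abs_integral_le_integral_abs zero_le_one
  · rw [zero_mul, add_zero]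
    refine Real.abs_le_sqrt ?_
    have := mul_nonneg (Real.rpow_nonneg (hγa u).1.le (-β))
      (sq_nonneg (baseSpeed I (fun v ↦ (γ v).2) u))
    linarith

/-- The calibration inequality below the height `K`. -/
theorem profileSlope_mul_abs_add_le (hβ : 0 < β) {K x ξ w : ℝ} (hx : 0 < x) (hxK : x ≤ K) :
    profileSlope β K x * |ξ| + K ^ (-(β / 2)) * w ≤ √(ξ ^ 2 + x ^ (-β) * w ^ 2) := by
  have hK : 0 < K := hx.trans_le hxK
  refine Real.le_sqrt_of_sq_le ?_
  have h1 : profileSlope β K x ^ 2 = 1 - (x / K) ^ β := by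
    refine Real.sq_sqrt ?_
    have := Real.rpow_le_one (by positivity) ((div_le_one hK).2 hxK) hβ.le
    linarith
  set z := x ^ (-(β / 2)) with hz
  have hz2 : x ^ (-β) = z ^ 2 := by
    rw [hz, ← Real.rpow_natCast, ← Real.rpow_mul hx.le]
    congr 1
    push_cast
    ring
  set r := (x / K) ^ (β / 2) with hr
  have hr2 : (x / K) ^ β = r ^ 2 := by
    rw [hr, ← Real.rpow_natCast, ← Real.rpow_mul (by positivity)]
    congr 1
    push_cast
    ring
  have hKz : K ^ (-(β / 2)) = r * z := by
    rw [hr, hz, Real.div_rpow hx.le hK.le, Real.rpow_neg hx.le, Real.rpow_neg hK.le]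
    have := Real.rpow_pos_of_pos hx (β / 2)
    field_simp
  rw [hr2] at h1
  rw [hz2, hKz, ← sq_abs ξ]
  -- This square is the defect in Cauchy–Schwarz for (√(1-r²), r) and (|ξ|, z w).
  nlinarith [sq_nonneg (r * |ξ| - profileSlope β K x * (z * w))]

/-- A curve that joins two points of small heights is at least as long as the geodesic of the model
`dx² + x^(-β) dy²` of the same width. -/
theorem boundaryConst_le_edist (hβ : 0 < β) (P Q : Collar I M β a)
    (hfin : riemannianEDist I P.base Q.base ≠ ⊤) :
    ENNReal.ofReal (boundaryConst β *
      (riemannianEDist I P.base Q.base).toReal ^ (2 / (2 + β)) - P.height - Q.height) ≤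
      edist P Q := by
  refine le_of_forall_gt fun r hr ↦ ?_
  obtain ⟨γ, h0, h1, hγ, hγa, hlen, -⟩ := collarEDist_lt hr zero_lt_one
  refine lt_of_le_of_lt ?_ hlen
  have hx : ContDiff ℝ 1 (fun v ↦ (γ v).1) := contMDiff_iff_contDiff.1 hγ.fst
  have hd : Continuous (deriv fun v ↦ (γ v).1) := hx.continuous_deriv le_rfl
  -- The calibration needs x ≤ K along the whole curve, and the ascent to K should count fully; both
  -- hold for K the maximal height, reached at time τ.
  obtain ⟨τ, hτ, hmax⟩ := isCompact_Icc.exists_isMaxOn (nonempty_Icc.2 zero_le_one)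
    (hx.continuous.continuousOn (s := Icc (0 : ℝ) 1))
  set K := (γ τ).1 with hKdef
  have hK : 0 < K := (hγa τ).1
  set φ : ℝ → ℝ := fun u ↦ profileSlope β K (γ u).1 * |deriv (fun v ↦ (γ v).1) u| with hφ
  have hφc : Continuous φ := ((continuous_profileSlope hβ.le).comp hx.continuous).mul hd.abs
  have key := le_collarLength (β := β) hγ zero_le_one (c := K ^ (-(β / 2))) (φ := φ)
    (by positivity) hφc (fun u ↦ mul_nonneg (profileSlope_nonneg _) (abs_nonneg _))
    fun u hu ↦ profileSlope_mul_abs_add_le hβ (hγa u).1 (hmax ⟨hu.1.le, hu.2.le⟩)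
  refine le_trans ?_ key
  rw [h0, h1]
  set d := (riemannianEDist I P.base Q.base).toReal
  rw [← ENNReal.ofReal_toReal hfin, ← ENNReal.ofReal_mul (by positivity),
    ← ENNReal.ofReal_add (intervalIntegral.integral_nonneg zero_le_one
      fun u _ ↦ mul_nonneg (profileSlope_nonneg _) (abs_nonneg _))
      (by positivity)]
  refine ENNReal.ofReal_le_ofReal ?_
  have hmain := boundaryConst_mul_rpow_le hβ hK (L := d) ENNReal.toReal_nonneg
  have hder (u : ℝ) : HasDerivAt (fun v ↦ profile β K (γ v).1)
      (profileSlope β K (γ u).1 * deriv (fun v ↦ (γ v).1) u) u :=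
    (hasDerivAt_profile hβ.le _).comp u (hx.differentiable one_ne_zero u).hasDerivAt
  have hcd : Continuous fun u ↦ profileSlope β K (γ u).1 * deriv (fun v ↦ (γ v).1) u :=
    ((continuous_profileSlope hβ.le).comp hx.continuous).mul hd
  have hup : profile β K K - profile β K P.height ≤ ∫ u in (0 : ℝ)..τ, φ u := by
    have := intervalIntegral.integral_eq_sub_of_hasDerivAt (a := 0) (b := τ)
      (fun u _ ↦ hder u) (hcd.intervalIntegrable _ _)
    simp only [h0] at this
    rw [hKdef, ← this]
    refine intervalIntegral.integral_mono_on hτ.1 (hcd.intervalIntegrable _ _)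
      (hφc.intervalIntegrable _ _) fun u _ ↦ ?_
    exact mul_le_mul_of_nonneg_left (le_abs_self _) (profileSlope_nonneg _)
  have hdown : profile β K K - profile β K Q.height ≤ ∫ u in τ..1, φ u := by
    have := intervalIntegral.integral_eq_sub_of_hasDerivAt (a := τ) (b := 1)
      (fun u _ ↦ (hder u).neg) (hcd.neg.intervalIntegrable _ _)
    simp only [h1, Pi.neg_apply] at this
    have e : profile β K K - profile β K Q.height =
        -profile β K Q.height - -profile β K (γ τ).1 := by ring
    rw [e, ← this]
    refine intervalIntegral.integral_mono_on hτ.2 (hcd.neg.intervalIntegrable _ _)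
      (hφc.intervalIntegrable _ _) fun u _ ↦ ?_
    rw [← mul_neg]
    exact mul_le_mul_of_nonneg_left (neg_le_abs _) (profileSlope_nonneg _)
  rw [← intervalIntegral.integral_add_adjacent_intervals (hφc.intervalIntegrable 0 τ)
    (hφc.intervalIntegrable τ 1)]
  -- The parts of ascent and descent missing below the endpoints cost at most the endpoint heights,
  -- which are the terms subtracted in the statement.
  have e1 := profile_le hβ.le hK P.height_mem.1.le
  have e2 := profile_le hβ.le hK Q.height_mem.1.le
  rw [profile_self hK] at hup hdown
  linarith

end Length

/-! ### Lifting curves of the model to the collar. -/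

section Lift

open MeasureTheory

variable {E : Type*} [NormedAddCommGroup E] [NormedSpace ℝ E]
  {H : Type*} [TopologicalSpace H] {I : ModelWithCorners ℝ E H}
  {M : Type*} [TopologicalSpace M] [ChartedSpace H M]
  [RiemannianBundle (fun m : M ↦ TangentSpace I m)] {β a : ℝ}

theorem continuous_baseSpeed [IsManifold I 1 M]
    [IsContinuousRiemannianBundle E (fun m : M ↦ TangentSpace I m)]
    {σ : ℝ → M} (hσ : CMDiff 1 σ) : Continuous (baseSpeed I σ) := by
  have h1 : Continuous fun t : ℝ ↦ (⟨t, (1 : ℝ)⟩ : TangentBundle 𝓘(ℝ, ℝ) ℝ) :=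
    (tangentBundleModelSpaceHomeomorph 𝓘(ℝ, ℝ)).symm.continuous.comp
      (continuous_id.prodMk (continuous_const (y := (1 : ℝ))))
  have h2 : Continuous fun t : ℝ ↦
      (⟨σ t, mfderiv 𝓘(ℝ, ℝ) I σ t (1 : ℝ)⟩ : TangentBundle I M) :=
    (hσ.continuous_tangentMap le_rfl).comp h1
  have h3 := (Continuous.inner_bundle (F := E) (E := fun m : M ↦ TangentSpace I m) h2 h2).sqrt
  refine h3.congr fun t ↦ ?_
  rw [baseSpeed, real_inner_self_eq_norm_sq, Real.sqrt_sq (norm_nonneg _)]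

theorem baseSpeed_comp {σ : ℝ → M} {f : ℝ → ℝ} {f' t : ℝ}
    (hσ : MDifferentiableAt 𝓘(ℝ, ℝ) I σ (f t)) (hf : HasDerivAt f f' t) :
    baseSpeed I (σ ∘ f) t = |f'| * baseSpeed I σ (f t) := by
  have h1 : (mfderiv 𝓘(ℝ, ℝ) 𝓘(ℝ, ℝ) f t (1 : ℝ) : ℝ) = f' • (1 : ℝ) := by
    rw [mfderiv_eq_fderiv]
    change fderiv ℝ f t 1 = _
    rw [hf.hasFDerivAt.fderiv]
    simp
  have h2 : mfderiv 𝓘(ℝ, ℝ) I (σ ∘ f) t (1 : ℝ) = f' • mfderiv 𝓘(ℝ, ℝ) I σ (f t) (1 : ℝ) := by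
    rw [mfderiv_comp t hσ hf.differentiableAt.mdifferentiableAt]
    exact (congrArg (mfderiv 𝓘(ℝ, ℝ) I σ (f t)) h1).trans (map_smul _ f' (1 : ℝ))
  unfold baseSpeed
  rw [h2]
  exact norm_smul _ _

/-- Two points can be joined by a `C¹` curve of speed at most one in any time larger than their
distance. -/
theorem exists_baseSpeed_le_one [IsManifold I 1 M]
    [IsContinuousRiemannianBundle E (fun m : M ↦ TangentSpace I m)] {p q : M} {L : ℝ}
    (h : riemannianEDist I p q < ENNReal.ofReal L) :
    ∃ σ : ℝ → M, CMDiff 1 σ ∧ (∀ t, baseSpeed I σ t ≤ 1) ∧ σ 0 = p ∧ σ L = q := by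
  obtain ⟨γ, h0, h1, hγ, hlen, -⟩ := exists_lt_locally_constant_of_riemannianEDist_lt h zero_lt_one
  have hv := continuous_baseSpeed hγ
  set ℓ := ∫ t in (0 : ℝ)..1, baseSpeed I γ t with hℓ
  have hℓL : ℓ < L := by
    rw [pathELength_eq_baseSpeed, ← ofReal_integral_eq_lintegral_ofReal
      ((hv.integrableOn_Icc (a := 0) (b := 1)).mono_set Ioo_subset_Icc_self)
      (Eventually.of_forall fun t ↦ baseSpeed_nonneg _ _), restrict_Ioo_eq_restrict_Ioc,
      ← intervalIntegral.integral_of_le zero_le_one] at hlen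
    exact (ENNReal.ofReal_lt_ofReal_iff_of_nonneg
      (intervalIntegral.integral_nonneg zero_le_one fun t _ ↦ baseSpeed_nonneg _ _)).1 hlen
  -- The spare time is spread evenly: with η added, the speed is bounded below by a positive
  -- constant even where `γ` stops. Its primitive `s` is then a C¹ diffeomorphism of ℝ with `s 1 =
  -- L`, and `γ` run along its inverse has speed at most 1.
  set η := L - ℓ with hη
  have hη0 : 0 < η := sub_pos.2 hℓL
  set v : ℝ → ℝ := fun t ↦ baseSpeed I γ t + η with hvdef
  have hvc : Continuous v := hv.add continuous_const
  have hvη (t : ℝ) : η ≤ v t := le_add_of_nonneg_left (baseSpeed_nonneg _ _)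
  have hvpos (t : ℝ) : 0 < v t := hη0.trans_le (hvη t)
  set s : ℝ → ℝ := fun t ↦ ∫ u in (0 : ℝ)..t, v u with hs
  have hsd (t : ℝ) : HasDerivAt s (v t) t :=
    intervalIntegral.integral_hasDerivAt_right (hvc.intervalIntegrable _ _)
      (hvc.stronglyMeasurableAtFilter _ _) hvc.continuousAt
  have hsC : ContDiff ℝ 1 s := by
    rw [contDiff_one_iff_deriv]
    refine ⟨fun t ↦ (hsd t).differentiableAt, ?_⟩
    rwa [funext fun t ↦ (hsd t).deriv]
  have hmono : StrictMono s := strictMono_of_hasDerivAt_pos hsd hvpos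
  have hs0 : s 0 = 0 := by simp [hs]
  have hs1 : s 1 = L := by
    rw [hs]
    simp only [hvdef]
    rw [intervalIntegral.integral_add (hv.intervalIntegrable _ _) (by simp)]
    simp [hη, ← hℓ]
  -- Growth at least linear in both directions makes `s` surjective.
  have hlin : Monotone fun t ↦ s t - η * t := by
    refine monotone_of_hasDerivAt_nonneg (fun t ↦ (hsd t).sub ((hasDerivAt_id t).const_mul η))
      fun t ↦ ?_
    simpa using hvη t
  have hsurj : Function.Surjective s := by
    refine hsC.continuous.surjective ?_ ?_
    · refine tendsto_atTop_mono' _ ?_ (tendsto_id.const_mul_atTop hη0)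
      filter_upwards [eventually_ge_atTop 0] with t ht
      have := hlin ht
      simp only [hs0, mul_zero, sub_zero] at this
      simpa using this
    · refine tendsto_atBot_mono' _ ?_ (tendsto_id.const_mul_atBot hη0)
      filter_upwards [eventually_le_atBot 0] with t ht
      have := hlin ht
      simp only [hs0, mul_zero, sub_zero] at this
      simpa using this
  let e : ℝ ≃ₜ ℝ := (hmono.orderIsoOfSurjective s hsurj).toHomeomorph
  have he : ∀ t, e t = s t := fun t ↦ rfl
  have heC : ContDiff ℝ 1 e.symm :=
    e.contDiff_symm_deriv (fun t ↦ (hvpos t).ne') hsd hsC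
  have hesd (t : ℝ) : HasDerivAt e.symm (v (e.symm t))⁻¹ t :=
    HasDerivAt.of_local_left_inverse e.symm.continuous.continuousAt (hsd _) (hvpos _).ne'
      (Eventually.of_forall fun u ↦ e.apply_symm_apply u)
  refine ⟨γ ∘ e.symm, hγ.comp heC.contMDiff, fun t ↦ ?_, ?_, ?_⟩
  · rw [baseSpeed_comp (hγ.mdifferentiable one_ne_zero _) (hesd t),
      abs_of_pos (inv_pos.2 (hvpos _)), inv_mul_le_iff₀ (hvpos _), mul_one]
    exact le_add_of_nonneg_right hη0.le
  · have : e.symm 0 = 0 := by rw [← hs0, ← he, e.symm_apply_apply, he, hs0]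
    simp [this, h0]
  · have : e.symm L = 1 := by rw [← hs1, ← he, e.symm_apply_apply]
    simp [this, h1]

/-- The curve `(x(t), σ(y(t)))` joins its endpoints and is not longer than `(x(t), y(t))` in the
model `dx² + x^(-β) dy²`. -/
theorem edist_le_of_lift {σ : ℝ → M} (hσ : CMDiff 1 σ) (hσ1 : ∀ t, baseSpeed I σ t ≤ 1)
    {x y x' y' G v : ℝ → ℝ} {s t : ℝ} (hst : s ≤ t)
    (hxC : ∀ u ∈ Icc s t, ContDiffAt ℝ 1 x u) (hyC : ∀ u ∈ Icc s t, ContDiffAt ℝ 1 y u)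
    (hx : ∀ u ∈ Ioo s t, HasDerivAt x (x' u) u) (hy : ∀ u ∈ Ioo s t, HasDerivAt y (y' u) u)
    (hG : ∀ u ∈ Icc s t, HasDerivAt G (v u) u) (hv : ContinuousOn v (Icc s t))
    (hxa : ∀ u ∈ Icc s t, x u ∈ Ioc 0 a)
    (hle : ∀ u ∈ Ioo s t, √(x' u ^ 2 + x u ^ (-β) * y' u ^ 2) ≤ v u)
    {P Q : Collar I M β a} (hP : P.height = x s) (hP' : P.base = σ (y s))
    (hQ : Q.height = x t) (hQ' : Q.base = σ (y t)) :
    edist P Q ≤ ENNReal.ofReal (G t - G s) := by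
  let γ : ℝ → ℝ × M := fun u ↦ (x u, σ (y u))
  -- The lifted curve is C¹ and inside the collar only over [s, t], so it is moved affinely to [0,
  -- 1] and inserted in the definition of the distance; `collarEDist_le` would require global
  -- smoothness.
  let f : ℝ → ℝ := fun u ↦ s + u * (t - s)
  have hf : ContDiff ℝ 1 f := by fun_prop
  have hts : 0 ≤ t - s := sub_nonneg.2 hst
  have hfm : MapsTo f (Icc 0 1) (Icc s t) := fun u hu ↦
    ⟨le_add_of_nonneg_right (mul_nonneg hu.1 hts), by
      have := mul_le_mul_of_nonneg_right hu.2 hts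
      change s + u * (t - s) ≤ t
      linarith⟩
  have hγ : ∀ u ∈ Icc s t, ContMDiffAt 𝓘(ℝ, ℝ) (𝓘(ℝ, ℝ).prod I) 1 γ u := fun u hu ↦
    (hxC u hu).contMDiffAt.prodMk (hσ.contMDiffAt.comp u (hyC u hu).contMDiffAt)
  have h1 : edist P Q ≤ collarLength I β (γ ∘ f) 0 1 := by
    refine iInf_le_of_le (γ ∘ f) (iInf_le_of_le ?_ (iInf_le_of_le (fun u hu ↦ hxa _ (hfm hu))
      (iInf_le_of_le ?_ (iInf_le_of_le ?_ le_rfl))))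
    · intro u hu
      exact ((hγ _ (hfm hu)).comp u hf.contMDiff.contMDiffAt).contMDiffWithinAt
    · simp [f, γ, hP, hP']
    · simp [f, γ, hQ, hQ']
  have h2 : collarLength I β (γ ∘ f) 0 1 = collarLength I β γ s t := by
    let _ : ∀ P : ℝ × M, ENorm (TangentSpace (𝓘(ℝ, ℝ).prod I) P) := collarENorm I β
    have := collarENormSMulClass (I := I) (M := M) β
    have h0 : f 0 = s := by simp [f]
    have h1 : f 1 = t := by simp [f]
    change pathELength (𝓘(ℝ, ℝ).prod I) (γ ∘ f) 0 1 = pathELength (𝓘(ℝ, ℝ).prod I) γ s t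
    rw [← h0, ← h1]
    refine pathELength_comp_of_monotoneOn zero_le_one ?_ ?_ ?_
    · refine Monotone.monotoneOn (fun u w huw ↦ ?_) _
      change s + u * (t - s) ≤ s + w * (t - s)
      gcongr
    · exact (hf.differentiable one_ne_zero).differentiableOn
    · rw [h0, h1]
      exact fun u hu ↦ ((hγ u hu).mdifferentiableAt one_ne_zero).mdifferentiableWithinAt
  have hvint : IntervalIntegrable v volume s t := hv.intervalIntegrable_of_Icc hst
  have h3 : ∫ u in s..t, v u = G t - G s :=
    intervalIntegral.integral_eq_sub_of_hasDerivAt (fun u hu ↦ hG u (by rwa [uIcc_of_le hst] at hu))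
      hvint
  rw [h2, collarLength_eq fun u hu ↦
    (hγ u (Ioo_subset_Icc_self hu)).mdifferentiableAt one_ne_zero] at h1
  refine h1.trans ?_
  have hv0 : ∀ u ∈ Ioo s t, 0 ≤ v u := fun u hu ↦ (Real.sqrt_nonneg _).trans (hle u hu)
  rw [← h3, intervalIntegral.integral_of_le hst, ← restrict_Ioo_eq_restrict_Ioc,
    ofReal_integral_eq_lintegral_ofReal
      ((hv.integrableOn_Icc).mono_set Ioo_subset_Icc_self)
      ((ae_restrict_mem measurableSet_Ioo).mono hv0)]
  refine setLIntegral_mono' measurableSet_Ioo fun u hu ↦ ENNReal.ofReal_le_ofReal ?_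
  refine le_trans (Real.sqrt_le_sqrt ?_) (hle u hu)
  have hu' := Ioo_subset_Icc_self hu
  have e1 : baseSpeed I (fun w ↦ (γ w).2) u ≤ |y' u| := by
    have := baseSpeed_comp (hσ.mdifferentiable one_ne_zero (y u)) (hy u hu)
    change baseSpeed I (σ ∘ y) u ≤ _
    rw [this]
    exact mul_le_of_le_one_right (abs_nonneg _) (hσ1 _)
  change deriv x u ^ 2 + x u ^ (-β) * baseSpeed I (fun w ↦ (γ w).2) u ^ 2 ≤ _
  rw [(hx u hu).deriv, ← sq_abs (y' u)]
  have := Real.rpow_nonneg (hxa u hu').1.le (-β)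
  have := baseSpeed_nonneg (I := I) (fun w ↦ (γ w).2) u
  gcongr

theorem edist_vertical_le {x y : ℝ} (hx : x ∈ Ioc 0 a) (hy : y ∈ Ioc 0 a) (m : M) :
    edist (⟨x, m, hx⟩ : Collar I M β a) ⟨y, m, hy⟩ ≤ ENNReal.ofReal |x - y| := by
  wlog h : x ≤ y generalizing x y
  · rw [edist_comm, abs_sub_comm]
    exact this hy hx (le_of_not_ge h)
  rw [abs_sub_comm, abs_of_nonneg (sub_nonneg.2 h)]
  refine edist_le_of_lift (σ := fun _ ↦ m) (x := id) (y := fun _ ↦ 0) (x' := fun _ ↦ 1)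
    (y' := fun _ ↦ 0) (G := id) (v := fun _ ↦ 1) contMDiff_const (fun t ↦ ?_) h
    (fun u _ ↦ contDiffAt_id) (fun u _ ↦ contDiffAt_const) (fun u _ ↦ hasDerivAt_id u)
    (fun u _ ↦ hasDerivAt_const u 0) (fun u _ ↦ hasDerivAt_id u) continuousOn_const
    (fun u hu ↦ ⟨hx.1.trans_le hu.1, hu.2.trans hy.2⟩) (fun u _ ↦ by simp) rfl rfl rfl rfl
  rw [baseSpeed, mfderiv_const]
  exact norm_zero.trans_le zero_le_one

variable [IsManifold I 1 M] [IsContinuousRiemannianBundle E (fun m : M ↦ TangentSpace I m)]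

/-- Lift an almost shortest curve of `M` at constant height. It is used to see that convergence of
the base at positive height implies convergence in the collar. -/
theorem edist_horizontal_le {x : ℝ} (hx : x ∈ Ioc 0 a) (m m' : M) :
    edist (⟨x, m, hx⟩ : Collar I M β a) ⟨x, m', hx⟩ ≤
      ENNReal.ofReal (x ^ (-(β / 2))) * riemannianEDist I m m' := by
  have hc := Real.rpow_pos_of_pos hx.1 (-(β / 2))
  set c := x ^ (-(β / 2)) with hcdef
  have hc2 : x ^ (-β) = c ^ 2 := by
    rw [hcdef, ← Real.rpow_natCast, ← Real.rpow_mul hx.1.le]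
    congr 1
    push_cast
    ring
  rw [mul_comm, ← ENNReal.div_le_iff (by simpa using hc) ENNReal.ofReal_ne_top]
  refine le_of_forall_gt fun r hr ↦ ?_
  obtain ⟨L, hL, hLr⟩ := ENNReal.lt_iff_exists_nnreal_btwn.1 hr
  refine lt_of_le_of_lt ?_ hLr
  rw [ENNReal.div_le_iff (by simpa using hc) ENNReal.ofReal_ne_top]
  obtain ⟨σ, hσ, hσ1, h0, h1⟩ := exists_baseSpeed_le_one (L := L) (by simpa using hL)
  have := edist_le_of_lift (β := β) (a := a) (x := fun _ ↦ x) (y := id) (x' := fun _ ↦ 0)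
    (y' := fun _ ↦ 1) (G := fun u ↦ c * u) (v := fun _ ↦ c) hσ hσ1 L.2
    (fun u _ ↦ contDiffAt_const) (fun u _ ↦ contDiffAt_id)
    (fun u _ ↦ hasDerivAt_const u x) (fun u _ ↦ hasDerivAt_id u)
    (fun u _ ↦ by simpa using (hasDerivAt_id u).const_mul c) continuousOn_const
    (fun u hu ↦ hx) (fun u _ ↦ by simp [hc2, Real.sqrt_sq hc.le])
    (P := ⟨x, m, hx⟩) (Q := ⟨x, m', hx⟩) rfl h0.symm rfl h1.symm
  refine this.trans_eq ?_
  change ENNReal.ofReal (c * (L : ℝ) - c * 0) = _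
  rw [mul_zero, sub_zero, mul_comm, ENNReal.ofReal_mul L.coe_nonneg, ENNReal.ofReal_coe_nnreal]

end Lift

/-! ### The geodesics of the model. -/

section Geodesic

open MeasureTheory

variable {E : Type*} [NormedAddCommGroup E] [NormedSpace ℝ E]
  {H : Type*} [TopologicalSpace H] {I : ModelWithCorners ℝ E H}
  {M : Type*} [TopologicalSpace M] [ChartedSpace H M]
  [RiemannianBundle (fun m : M ↦ TangentSpace I m)] {β a : ℝ}

/-- With s = sin t and c = cos t, the components x' and x^(-β/2) y' are c and s times the common
factor on the right. -/
theorem geodesic_speed (hβ : 0 < β) {h s c : ℝ} (hh : 0 < h) (hs : 0 < s)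
    (hsc : s ^ 2 + c ^ 2 = 1) :
    √((h * (c * (2 / β) * s ^ (2 / β - 1))) ^ 2 + (h * s ^ (2 / β)) ^ (-β) *
      (2 / β * h ^ (1 + β / 2) * s ^ (2 / β + 1)) ^ 2) = h * (2 / β) * s ^ (2 / β - 1) := by
  have e1 : s ^ (2 / β + 1) = s ^ (2 / β - 1) * s ^ 2 := by
    rw [← Real.rpow_two, ← Real.rpow_add hs]
    congr 1
    ring
  have e2 : (h * s ^ (2 / β)) ^ (-β) = (h ^ β)⁻¹ * (s ^ 2)⁻¹ := by
    rw [Real.mul_rpow hh.le (by positivity), ← Real.rpow_mul hs.le, Real.rpow_neg hh.le,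
      ← Real.rpow_two, ← Real.rpow_neg hs.le]
    congr 2
    field_simp
  have e3 : (h ^ (1 + β / 2)) ^ 2 = h ^ 2 * h ^ β := by
    rw [← Real.rpow_two, ← Real.rpow_two, ← Real.rpow_mul hh.le, ← Real.rpow_add hh]
    congr 1
    ring
  have hb := Real.rpow_pos_of_pos hh β
  have hS := Real.rpow_pos_of_pos hs (2 / β - 1)
  rw [Real.sqrt_eq_iff_eq_sq (by positivity) (by positivity), e1, e2, mul_pow (2 / β * _),
    mul_pow (2 / β), e3]
  generalize s ^ (2 / β - 1) = S at *
  generalize h ^ β = k at *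
  field_simp
  linear_combination hsc

variable [IsManifold I 1 M] [IsContinuousRiemannianBundle E (fun m : M ↦ TangentSpace I m)]

/-- The geodesics of the model `dx² + x^(-β) dy²` of maximal height `h` lift to short curves in the
collar. -/
theorem exists_edist_le_of_height (hβ : 0 < β) {h : ℝ} (hh : 0 < h) (hha : h ≤ a) {p q : M}
    (hpq : riemannianEDist I p q < ENNReal.ofReal (4 * profile β 1 1 / β * h ^ (1 + β / 2)))
    {ε : ℝ} (hε : 0 < ε) :
    ∃ x, ∃ hx : x ∈ Ioc 0 a, x < ε ∧ edist (⟨x, p, hx⟩ : Collar I M β a) ⟨x, q, hx⟩ ≤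
      ENNReal.ofReal (2 * profile β 1 1 * h * (1 + 2 / β)) := by
  set f : ℝ → ℝ := fun t ↦ Real.sin t ^ (2 / β + 1) with hf
  have hfc : Continuous f := (Real.continuous_rpow_const (by positivity)).comp Real.continuous_sin
  have hfi (s t : ℝ) : IntervalIntegrable f volume s t := hfc.intervalIntegrable _ _
  have hint (s t : ℝ) : HasDerivAt (fun t ↦ ∫ u in s..t, f u) (f t) t :=
    intervalIntegral.integral_hasDerivAt_right (hfi _ _) (hfc.stronglyMeasurableAtFilter _ _)
      hfc.continuousAt
  have hintC (s : ℝ) : Continuous (fun t ↦ ∫ u in s..t, f u) :=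
    continuous_iff_continuousAt.2 fun t ↦ (hint s t).continuousAt
  -- The geodesic reaches height 0 at t = 0 and t = π, outside the collar, so it is cut off at δ and
  -- π - δ. Its width becomes C · J δ, and the strict inequality `hpq` survives for small δ.
  set J : ℝ → ℝ := fun δ ↦ ∫ u in δ..(Real.pi - δ), f u with hJ
  have hJ0 : J 0 = 2 * profile β 1 1 := by
    simp only [hJ, sub_zero]
    exact integral_sin_rpow_eq_profile hβ
  have hJc : Continuous J := by
    have : J = fun δ ↦ (∫ u in (0 : ℝ)..(Real.pi - δ), f u) - ∫ u in (0 : ℝ)..δ, f u := by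
      ext δ
      rw [intervalIntegral.integral_interval_sub_left (hfi _ _) (hfi _ _)]
    rw [this]
    exact ((hintC 0).comp (continuous_const.sub continuous_id)).sub (hintC 0)
  set C : ℝ := 2 / β * h ^ (1 + β / 2) with hC
  have hC0 : 0 < C := by positivity
  have hsinc : Continuous fun t ↦ h * Real.sin t ^ (2 / β) :=
    continuous_const.mul
      ((Real.continuous_rpow_const (by positivity)).comp Real.continuous_sin)
  have hev1 : ∀ᶠ δ in 𝓝[>] (0 : ℝ), riemannianEDist I p q < ENNReal.ofReal (C * J δ) := by
    refine nhdsWithin_le_nhds ?_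
    have hct : Continuous fun δ ↦ ENNReal.ofReal (C * J δ) :=
      ENNReal.continuous_ofReal.comp (continuous_const.mul hJc)
    refine hct.continuousAt.eventually (lt_mem_nhds ?_)
    beta_reduce
    rw [hJ0]
    convert hpq using 2
    rw [hC]
    ring
  have hev2 : ∀ᶠ δ in 𝓝[>] (0 : ℝ), h * Real.sin δ ^ (2 / β) < ε := by
    refine nhdsWithin_le_nhds (hsinc.continuousAt.eventually (gt_mem_nhds ?_))
    beta_reduce
    rw [Real.sin_zero, Real.zero_rpow (by positivity)]
    simpa using hε
  obtain ⟨δ, ⟨hd, hxε⟩, hδ0, hδ1⟩ := ((hev1.and hev2).and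
    (Ioo_mem_nhdsGT (show (0 : ℝ) < Real.pi / 2 by positivity))).exists
  have hpi := Real.pi_pos
  have hδπ : δ ≤ Real.pi - δ := by linarith
  have hsin : ∀ u ∈ Icc δ (Real.pi - δ), 0 < Real.sin u := fun u hu ↦
    Real.sin_pos_of_pos_of_lt_pi (hδ0.trans_le hu.1) (by linarith [hu.2])
  have hxmem : ∀ u ∈ Icc δ (Real.pi - δ), h * Real.sin u ^ (2 / β) ∈ Ioc 0 a := by
    intro u hu
    have hs := hsin u hu
    refine ⟨by positivity, (mul_le_of_le_one_right hh.le ?_).trans hha⟩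
    exact Real.rpow_le_one hs.le (Real.sin_le_one u) (by positivity)
  have hδmem : δ ∈ Icc δ (Real.pi - δ) := ⟨le_rfl, hδπ⟩
  obtain ⟨σ, hσ, hσ1, h0, h1⟩ := exists_baseSpeed_le_one hd
  refine ⟨_, hxmem δ hδmem, hxε, ?_⟩
  have hder : ∀ u ∈ Icc δ (Real.pi - δ), HasDerivAt (fun t ↦ Real.sin t ^ (2 / β))
      (Real.cos u * (2 / β) * Real.sin u ^ (2 / β - 1)) u := fun u hu ↦
    (Real.hasDerivAt_sin u).rpow_const (Or.inl (hsin u hu).ne')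
  have hyC : ContDiff ℝ 1 fun t ↦ C * ∫ u in δ..t, f u := by
    rw [contDiff_one_iff_deriv]
    refine ⟨fun t ↦ ((hint δ t).const_mul C).differentiableAt, ?_⟩
    rw [funext fun t ↦ ((hint δ t).const_mul C).deriv]
    exact continuous_const.mul hfc
  -- The primitive `G` of the speed comes from (sin^(2/β) cos)' = (2/β) sin^(2/β-1) - (1+2/β)
  -- sin^(2/β+1). Over [δ, π - δ] its boundary term is nonpositive and can be dropped.
  have key := edist_le_of_lift (β := β) (a := a) hσ hσ1 (s := δ) (t := Real.pi - δ)
    (x := fun t ↦ h * Real.sin t ^ (2 / β)) (y := fun t ↦ C * ∫ u in δ..t, f u)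
    (x' := fun t ↦ h * (Real.cos t * (2 / β) * Real.sin t ^ (2 / β - 1)))
    (y' := fun t ↦ C * f t)
    (G := fun t ↦ h * (Real.sin t ^ (2 / β) * Real.cos t + (1 + 2 / β) * ∫ u in δ..t, f u))
    (v := fun t ↦ h * (2 / β) * Real.sin t ^ (2 / β - 1)) hδπ
    (fun u hu ↦ contDiffAt_const.mul
      (Real.contDiff_sin.contDiffAt.rpow_const_of_ne (hsin u hu).ne'))
    (fun u _ ↦ hyC.contDiffAt) (fun u hu ↦ (hder u (Ioo_subset_Icc_self hu)).const_mul h)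
    (fun u _ ↦ (hint δ u).const_mul C) (fun u hu ↦ ?_)
    (continuousOn_const.mul (Real.continuous_sin.continuousOn.rpow_const
      fun u hu ↦ Or.inl (hsin u hu).ne')) hxmem
    (fun u hu ↦ (geodesic_speed hβ hh (hsin u (Ioo_subset_Icc_self hu))
      (Real.sin_sq_add_cos_sq u)).le)
    (P := ⟨_, p, hxmem δ hδmem⟩) (Q := ⟨_, q, hxmem δ hδmem⟩) rfl (by simp [h0])
    (by simp) h1.symm
  · refine key.trans (ENNReal.ofReal_le_ofReal ?_)
    have hJle : J δ ≤ 2 * profile β 1 1 := by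
      rw [← hJ0]
      simp only [hJ, sub_zero]
      refine intervalIntegral.integral_mono_interval hδ0.le hδπ (by linarith) ?_ (hfi _ _)
      refine (ae_restrict_mem measurableSet_Ioc).mono fun u hu ↦ ?_
      exact Real.rpow_nonneg (Real.sin_nonneg_of_nonneg_of_le_pi hu.1.le hu.2) _
    have hcos : 0 ≤ Real.cos δ := Real.cos_nonneg_of_mem_Icc ⟨by linarith, hδ1.le⟩
    have hs := hsin δ hδmem
    have hprod : 0 ≤ h * (Real.sin δ ^ (2 / β) * Real.cos δ) := by positivity
    have hJ2 : h * (1 + 2 / β) * J δ ≤ h * (1 + 2 / β) * (2 * profile β 1 1) := by gcongr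
    simp only [Real.sin_pi_sub, Real.cos_pi_sub, intervalIntegral.integral_same]
    change h * (Real.sin δ ^ (2 / β) * -Real.cos δ + (1 + 2 / β) * J δ) - _ ≤ _
    linarith
  · have hs := hsin u hu
    refine ((((hder u hu).mul (Real.hasDerivAt_cos u)).add
      ((hint δ u).const_mul (1 + 2 / β))).const_mul h).congr_deriv ?_
    have e1 : Real.sin u ^ (2 / β + 1) = Real.sin u ^ (2 / β - 1) * Real.sin u ^ 2 := by
      rw [← Real.rpow_two, ← Real.rpow_add hs]
      congr 1
      ring
    have e2 : Real.sin u ^ (2 / β) = Real.sin u ^ (2 / β - 1) * Real.sin u := by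
      rw [← Real.rpow_add_one hs.ne', sub_add_cancel]
    simp only [hf]
    rw [e1, e2, Real.sin_sq]
    generalize Real.sin u ^ (2 / β - 1) = S
    linear_combination (-(h * S)) * Real.sin_sq_add_cos_sq u

end Geodesic

/-! ### The boundary points of the completion and their distances. -/

section Boundary

variable {E : Type*} [NormedAddCommGroup E] [NormedSpace ℝ E]
  {H : Type*} [TopologicalSpace H] {I : ModelWithCorners ℝ E H}
  {M : Type*} [TopologicalSpace M] [ChartedSpace H M]
  [RiemannianBundle (fun m : M ↦ TangentSpace I m)] {β a : ℝ}

theorem edist_coe_collar (P Q : Collar I M β a) :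
    edist (P : Completion (Collar I M β a)) (Q : Completion (Collar I M β a)) = edist P Q :=
  completionEDist_coe P Q

/-- `z` is the limit at height `0` of the vertical segment over `m`. -/
def IsBoundaryLimit (m : M) (z : Completion (Collar I M β a)) : Prop :=
  Tendsto (fun x : Ioc 0 a ↦
    ((⟨x, m, x.2⟩ : Collar I M β a) : Completion (Collar I M β a)))
    (comap Subtype.val (𝓝 0)) (𝓝 z)

theorem comap_val_nhds_zero_neBot (ha : 0 < a) :
    (comap (Subtype.val : Ioc 0 a → ℝ) (𝓝 0)).NeBot := by
  rw [← mem_closure_iff_comap_neBot, closure_Ioc ha.ne]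
  exact ⟨le_rfl, ha.le⟩

/-- The vertical segment is a 1-Lipschitz image of (0, a], so it carries the Cauchy filter at 0 to a
Cauchy filter. -/
theorem exists_isBoundaryLimit (ha : 0 < a) (m : M) :
    ∃ z : Completion (Collar I M β a), IsBoundaryLimit m z := by
  have := comap_val_nhds_zero_neBot ha
  have hg : UniformContinuous fun x : Ioc 0 a ↦ (⟨x, m, x.2⟩ : Collar I M β a) := by
    refine LipschitzWith.uniformContinuous (K := 1) fun x y ↦ ?_
    rw [ENNReal.coe_one, one_mul]
    refine (edist_vertical_le x.2 y.2 m).trans_eq ?_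
    rw [Subtype.edist_eq, edist_dist, Real.dist_eq]
  have hc : Cauchy (comap (Subtype.val : Ioc 0 a → ℝ) (𝓝 0)) :=
    (cauchy_nhds (a := (0 : ℝ))).comap' le_rfl this
  exact CompleteSpace.complete
    (hc.map ((Completion.uniformContinuous_coe (Collar I M β a)).comp hg))

theorem IsBoundaryLimit.tendsto_edist {p q : M} {z w : Completion (Collar I M β a)}
    (hz : IsBoundaryLimit p z) (hw : IsBoundaryLimit q w) :
    Tendsto (fun x : Ioc 0 a ↦ edist (⟨x, p, x.2⟩ : Collar I M β a) ⟨x, q, x.2⟩)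
      (comap Subtype.val (𝓝 0)) (𝓝 (edist z w)) :=
  (hz.edist hw).congr fun _ ↦ edist_coe_collar _ _

theorem rpow_mul_riemannianEDist_le_of_isBoundaryLimit (hβ : 0 ≤ β) (ha : 0 < a) {p q : M}
    {z w : Completion (Collar I M β a)} (hz : IsBoundaryLimit p z) (hw : IsBoundaryLimit q w) :
    ENNReal.ofReal (a ^ (-(β / 2))) * riemannianEDist I p q ≤ edist z w := by
  have := comap_val_nhds_zero_neBot ha
  exact ge_of_tendsto' (hz.tendsto_edist hw) fun x ↦ rpow_mul_riemannianEDist_le hβ ha _ _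

theorem edist_coe_isBoundaryLimit_le (ha : 0 < a) {m : M} {z : Completion (Collar I M β a)}
    (hz : IsBoundaryLimit m z) {x : ℝ} (hx : x ∈ Ioc 0 a) :
    edist ((⟨x, m, hx⟩ : Collar I M β a) : Completion (Collar I M β a)) z ≤ ENNReal.ofReal x := by
  have := comap_val_nhds_zero_neBot ha
  have h1 : Tendsto (fun y : Ioc 0 a ↦ ENNReal.ofReal |x - y|) (comap Subtype.val (𝓝 0))
      (𝓝 (ENNReal.ofReal x)) := by
    have hc : Continuous fun y : ℝ ↦ ENNReal.ofReal |x - y| :=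
      ENNReal.continuous_ofReal.comp (continuous_const.sub continuous_id).abs
    have := (hc.tendsto 0).comp (tendsto_comap (f := (Subtype.val : Ioc 0 a → ℝ)))
    rwa [sub_zero, abs_of_pos hx.1] at this
  refine le_of_tendsto_of_tendsto' (tendsto_const_nhds.edist hz) h1 fun y ↦ ?_
  rw [edist_coe_collar]
  exact edist_vertical_le hx y.2 m

theorem ofReal_height_le_edist (ha : 0 < a) {m : M} {z : Completion (Collar I M β a)}
    (hz : IsBoundaryLimit m z) (P : Collar I M β a) :
    ENNReal.ofReal P.height ≤ edist (P : Completion (Collar I M β a)) z := by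
  have := comap_val_nhds_zero_neBot ha
  have h1 : Tendsto (fun y : Ioc 0 a ↦ ENNReal.ofReal |P.height - y|) (comap Subtype.val (𝓝 0))
      (𝓝 (ENNReal.ofReal P.height)) := by
    have hc : Continuous fun y : ℝ ↦ ENNReal.ofReal |P.height - y| :=
      ENNReal.continuous_ofReal.comp (continuous_const.sub continuous_id).abs
    have := (hc.tendsto 0).comp (tendsto_comap (f := (Subtype.val : Ioc 0 a → ℝ)))
    rwa [sub_zero, abs_of_pos P.height_mem.1] at this
  refine le_of_tendsto_of_tendsto' h1 (tendsto_const_nhds.edist hz) fun y ↦ ?_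
  rw [edist_coe_collar]
  exact ofReal_abs_height_sub_le P ⟨y, m, y.2⟩

variable [IsManifold I 1 M] [IsContinuousRiemannianBundle E (fun m : M ↦ TangentSpace I m)]

/-- For nearby points the distance in the boundary is exactly the distance in the model
`dx² + x^(-β) dy²`. -/
theorem edist_eq_of_isBoundaryLimit (hβ : 0 < β) (ha : 0 < a) {p q : M}
    {z w : Completion (Collar I M β a)} (hz : IsBoundaryLimit p z) (hw : IsBoundaryLimit q w)
    (hpq : riemannianEDist I p q < ENNReal.ofReal (4 * profile β 1 1 / β * a ^ (1 + β / 2))) :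
    edist z w = ENNReal.ofReal
      (boundaryConst β * (riemannianEDist I p q).toReal ^ (2 / (2 + β))) := by
  have := comap_val_nhds_zero_neBot ha
  have hA := profile_one_pos hβ
  have hfin : riemannianEDist I p q ≠ ⊤ := hpq.ne_top
  have hlim := hz.tendsto_edist hw
  set d := (riemannianEDist I p q).toReal with hd
  have hd0 : 0 ≤ d := ENNReal.toReal_nonneg
  have hdd : riemannianEDist I p q = ENNReal.ofReal d := (ENNReal.ofReal_toReal hfin).symm
  have hdL : d < 4 * profile β 1 1 / β * a ^ (1 + β / 2) := by
    rwa [hdd, ENNReal.ofReal_lt_ofReal_iff_of_nonneg hd0] at hpq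
  refine le_antisymm ?_ ?_
  · have hcont : Continuous fun L : ℝ ↦ ENNReal.ofReal (boundaryConst β * L ^ (2 / (2 + β))) :=
      ENNReal.continuous_ofReal.comp
        (continuous_const.mul (Real.continuous_rpow_const (by positivity)))
    -- The distance d need not be attained by a curve, so the bound is proved for every L slightly
    -- larger than d and passes to the limit L → d.
    refine ge_of_tendsto (hcont.continuousWithinAt (s := Ioi d)) ?_
    filter_upwards [Ioo_mem_nhdsGT hdL] with L hL
    have hL0 : 0 < L := hd0.trans_lt hL.1
    obtain ⟨hh, hhL⟩ := exists_height hβ hL0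
    set h := (β * L / (4 * profile β 1 1)) ^ (2 / (2 + β))
    have hha : h ≤ a := by
      by_contra! hcon
      refine hL.2.not_ge ?_
      rw [← hhL]
      gcongr
    rw [← hhL, boundaryConst_mul_rpow hβ hh]
    -- The geodesics give the bound only at some heights below each ε. This is enough because the
    -- limit is already known to exist.
    refine le_of_tendsto_of_frequently hlim ?_
    rw [(Metric.nhds_basis_ball.comap _).frequently_iff]
    intro ε hε
    obtain ⟨x, hx, hxε, hle⟩ := exists_edist_le_of_height (a := a) hβ hh hha (p := p) (q := q)
      (by rw [hhL, hdd]; exact (ENNReal.ofReal_lt_ofReal_iff hL0).2 hL.1) hε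
    refine ⟨⟨x, hx⟩, ?_, hle⟩
    simpa [abs_of_pos hx.1] using hxε
  · have h1 : Tendsto (fun x : Ioc 0 a ↦
        ENNReal.ofReal (boundaryConst β * d ^ (2 / (2 + β)) - x - x)) (comap Subtype.val (𝓝 0))
        (𝓝 (ENNReal.ofReal (boundaryConst β * d ^ (2 / (2 + β))))) := by
      have hc : Continuous fun x : ℝ ↦
          ENNReal.ofReal (boundaryConst β * d ^ (2 / (2 + β)) - x - x) :=
        ENNReal.continuous_ofReal.comp ((continuous_const.sub continuous_id).sub continuous_id)
      have := (hc.tendsto 0).comp (tendsto_comap (f := (Subtype.val : Ioc 0 a → ℝ)))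
      rwa [sub_zero, sub_zero] at this
    exact le_of_tendsto_of_tendsto' h1 hlim fun x ↦
      boundaryConst_le_edist hβ ⟨x, p, x.2⟩ ⟨x, q, x.2⟩ hfin

theorem tendsto_riemannianEDist (p : M) : Tendsto (riemannianEDist I p) (𝓝 p) (𝓝 0) := by
  refine ENNReal.tendsto_nhds_zero.2 fun ε hε ↦ ?_
  exact (eventually_riemannianEDist_lt I p hε).mono fun q hq ↦ hq.le

theorem eventually_edist_eq (hβ : 0 < β) (ha : 0 < a) {ι : M → Completion (Collar I M β a)}
    (hι : ∀ m, IsBoundaryLimit m (ι m)) (p : M) :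
    ∀ᶠ q in 𝓝 p, edist (ι p) (ι q) = ENNReal.ofReal
      (boundaryConst β * (riemannianEDist I p q).toReal ^ (2 / (2 + β))) := by
  have hA := profile_one_pos hβ
  filter_upwards [eventually_riemannianEDist_lt I p
    (c := ENNReal.ofReal (4 * profile β 1 1 / β * a ^ (1 + β / 2)))
    (ENNReal.ofReal_pos.2 (by positivity))] with q hq
  exact edist_eq_of_isBoundaryLimit hβ ha (hι p) (hι q) hq

theorem tendsto_edist_boundary (hβ : 0 < β) (ha : 0 < a) {ι : M → Completion (Collar I M β a)}
    (hι : ∀ m, IsBoundaryLimit m (ι m)) (p : M) :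
    Tendsto (fun q ↦ edist (ι q) (ι p)) (𝓝 p) (𝓝 0) := by
  have h1 : Tendsto (fun q ↦ (riemannianEDist I p q).toReal) (𝓝 p) (𝓝 0) :=
    (ENNReal.tendsto_toReal ENNReal.zero_ne_top).comp (tendsto_riemannianEDist p)
  have hcont : Continuous fun L : ℝ ↦ ENNReal.ofReal (boundaryConst β * L ^ (2 / (2 + β))) :=
    ENNReal.continuous_ofReal.comp
      (continuous_const.mul (Real.continuous_rpow_const (by positivity)))
  have h2 := (hcont.tendsto 0).comp h1
  rw [Real.zero_rpow (by positivity), mul_zero, ENNReal.ofReal_zero] at h2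
  refine h2.congr' ?_
  filter_upwards [eventually_edist_eq hβ ha hι p] with q hq
  rw [edist_comm, hq]
  rfl

theorem injective_of_isBoundaryLimit [T3Space M] (hβ : 0 < β) (ha : 0 < a)
    {ι : M → Completion (Collar I M β a)} (hι : ∀ m, IsBoundaryLimit m (ι m)) :
    Function.Injective ι := by
  intro p q hpq
  by_contra hne
  have hd : 0 < riemannianEDist I p q := by
    let : EMetricSpace M := .ofRiemannianMetric I M
    exact edist_pos.2 hne
  have h := rpow_mul_riemannianEDist_le_of_isBoundaryLimit hβ.le ha (hι p) (hι q)
  rw [hpq, edist_self] at h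
  exact (ENNReal.mul_pos (ENNReal.ofReal_pos.2 (by positivity)).ne' hd.ne').not_ge h

/-- A boundary limit is at distance at least the height from any collar point, hence is not one.
Conversely, a point of the completion is the limit of an ultrafilter on the collar, along which the
base converges by compactness of `M` and the height by compactness of [0, a]. -/
theorem range_eq_of_isBoundaryLimit [CompactSpace M] (hβ : 0 < β) (ha : 0 < a)
    {ι : M → Completion (Collar I M β a)} (hι : ∀ m, IsBoundaryLimit m (ι m)) :
    range ι = (range ((↑) : Collar I M β a → Completion (Collar I M β a)))ᶜ := by
  refine Subset.antisymm ?_ fun z hz ↦ ?_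
  · rintro _ ⟨m, rfl⟩ ⟨P, hP⟩
    have h := ofReal_height_le_edist ha (hι m) P
    rw [hP, edist_self] at h
    exact (ENNReal.ofReal_pos.2 P.height_mem.1).not_ge h
  · have hne : (comap ((↑) : Collar I M β a → Completion (Collar I M β a)) (𝓝 z)).NeBot :=
      Completion.isDenseInducing_coe.comap_nhds_neBot z
    let U : Ultrafilter (Collar I M β a) := Ultrafilter.of (comap (↑) (𝓝 z))
    have hUz : Tendsto ((↑) : Collar I M β a → Completion (Collar I M β a)) U (𝓝 z) :=
      tendsto_comap.mono_left (Ultrafilter.of_le _)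
    have hbase := Ultrafilter.le_nhds_lim (U.map Collar.base)
    set m := (U.map Collar.base).lim
    have hbase : Tendsto Collar.base (U : Filter (Collar I M β a)) (𝓝 m) := hbase
    obtain ⟨x, hx, hxU⟩ := (isCompact_Icc (a := (0 : ℝ)) (b := a)).ultrafilter_le_nhds
      (U.map Collar.height) (by
        rw [Ultrafilter.coe_map, le_principal_iff, mem_map]
        exact univ_mem' fun P ↦ Ioc_subset_Icc_self P.height_mem)
    have hheight : Tendsto Collar.height (U : Filter (Collar I M β a)) (𝓝 x) := hxU
    have hheight' : Tendsto (fun P : Collar I M β a ↦ ENNReal.ofReal |P.height - x|) U (𝓝 0) := by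
      have hc : Continuous fun y : ℝ ↦ ENNReal.ofReal |y - x| :=
        ENNReal.continuous_ofReal.comp (continuous_id.sub continuous_const).abs
      have := (hc.tendsto x).comp hheight
      rwa [sub_self, abs_zero, ENNReal.ofReal_zero] at this
    -- Height tending to 0: each point is within its height of the boundary point above its base,
    -- and `ι` is continuous. Positive limit height: the ultrafilter converges to the collar point
    -- (x, m), which is excluded.
    rcases hx.1.eq_or_lt with rfl | hx0
    · refine ⟨m, tendsto_nhds_unique (f := ((↑) : Collar I M β a → Completion (Collar I M β a)))
        (l := U) ?_ hUz⟩
      rw [tendsto_iff_edist_tendsto_0]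
      have h2 := hheight'.add ((tendsto_edist_boundary hβ ha hι m).comp hbase)
      rw [add_zero] at h2
      refine tendsto_of_tendsto_of_tendsto_of_le_of_le tendsto_const_nhds h2 (fun _ ↦ bot_le)
        fun P ↦ (edist_triangle _ (ι P.base) _).trans (add_le_add_left ?_ _)
      simpa [abs_of_pos P.height_mem.1] using
        edist_coe_isBoundaryLimit_le ha (hι P.base) P.height_mem
    · refine absurd ⟨⟨x, m, hx0, hx.2⟩, tendsto_nhds_unique
        (f := ((↑) : Collar I M β a → Completion (Collar I M β a))) (l := U) ?_ hUz⟩ hz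
      rw [tendsto_iff_edist_tendsto_0]
      have h3 := ENNReal.Tendsto.const_mul (a := ENNReal.ofReal (x ^ (-(β / 2))))
        ((tendsto_riemannianEDist (I := I) m).comp hbase) (Or.inr ENNReal.ofReal_ne_top)
      have h2 := hheight'.add h3
      rw [mul_zero, add_zero] at h2
      refine tendsto_of_tendsto_of_tendsto_of_le_of_le tendsto_const_nhds h2 (fun _ ↦ bot_le)
        fun P ↦ ?_
      beta_reduce
      rw [edist_coe_collar]
      have e1 := edist_vertical_le (I := I) (β := β) P.height_mem ⟨hx0, hx.2⟩ P.base
      have e2 := edist_horizontal_le (I := I) (β := β) (a := a) ⟨hx0, hx.2⟩ m P.base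
      rw [edist_comm] at e2
      exact (edist_triangle _ _ _).trans (add_le_add e1 e2)

end Boundary

end

theorem lemmaA6 {n : ℕ} {M : Type*} [TopologicalSpace M] [T2Space M] [CompactSpace M]
    [ChartedSpace (EuclideanSpace ℝ (Fin n)) M] [IsManifold (𝓡 n) ∞ M]
    [RiemannianBundle (fun m : M ↦ TangentSpace (𝓡 n) m)]
    [IsContMDiffRiemannianBundle (𝓡 n) 1 (EuclideanSpace ℝ (Fin n))
      (fun m : M ↦ TangentSpace (𝓡 n) m)]
    {β a : ℝ} (hβ : 0 < β) (ha : 0 < a) :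
    ∃ ι : M → Completion (Collar (𝓡 n) M β a),
      (∀ m : M, Tendsto
        (fun x : Ioc 0 a ↦
          ((⟨x, m, x.2⟩ : Collar (𝓡 n) M β a) : Completion (Collar (𝓡 n) M β a)))
        (comap Subtype.val (𝓝 0)) (𝓝 (ι m))) ∧
      Function.Injective ι ∧
      range ι = (range ((↑) : Collar (𝓡 n) M β a → Completion (Collar (𝓡 n) M β a)))ᶜ ∧
      ∀ p : M, Asymptotics.IsEquivalent (𝓝 p)
        (fun q ↦ (edist (ι p) (ι q)).toReal)
        (fun q ↦ boundaryConst β * (riemannianEDist (𝓡 n) p q).toReal ^ (2 / (2 + β))) := by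
  -- Only continuity of `h₀` enters the argument.
  have : IsContinuousRiemannianBundle (EuclideanSpace ℝ (Fin n))
      (fun m : M ↦ TangentSpace (𝓡 n) m) :=
    let ⟨g, hg, hgi⟩ := IsContMDiffRiemannianBundle.exists_contMDiff (IB := 𝓡 n) (n := 1)
      (F := EuclideanSpace ℝ (Fin n)) (E := fun m : M ↦ TangentSpace (𝓡 n) m)
    ⟨g, hg.continuous, hgi⟩
  choose ι hι using fun m : M ↦ exists_isBoundaryLimit (I := 𝓡 n) (β := β) ha m
  refine ⟨ι, hι, injective_of_isBoundaryLimit hβ ha hι, range_eq_of_isBoundaryLimit hβ ha hι,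
    -- The two functions agree near p, so the factor 1 + o(1) is eventually 1.
    fun p ↦ EventuallyEq.isEquivalent ?_⟩
  filter_upwards [eventually_edist_eq hβ ha hι p] with q hq
  rw [hq, ENNReal.toReal_ofReal]
  rw [boundaryConst_eq hβ]
  have := profile_one_pos hβ
  positivity
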